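/- Let $(M_1,g_1)$ and $(M_2,g_2)$ be smooth finite-dimensional (Hausdorff) Riemannian manifolds without boundary, with Levi-Civita connections $\nabla^1,\nabla^2$; write $\nabla^2$ also for the pullback of $\nabla^2$ along maps into $M_2$. Let $F:M_1\to M_2$ be a Riemannian map, i.e. a smooth map such that for every $p\in M_1$ the restriction $F_{*p}:(\ker F_{*p})^\perp\to\operatorname{range}F_{*p}$ is a linear isometry, and assume that $\operatorname{rank}F_{*p}>0$ for every $p$. Write $\Gamma((\ker F_*)^\perp)$ for the smooth horizontal vector fields on $M_1$, and let $(\nabla F_*)(X,Y)=\nabla^2_X(F_*Y)-F_*(\nabla^1_XY)$ be the second fundamental form of $F$. Let $H_2$ be the mean curvature vector field of $\operatorname{range}F_*$, that is, $$H_2(p)=\frac1{m_2}\sum_{i=1}^{m_2}\bigl(\nabla^2_{e_i}F_*e_i\bigr)^{\perp},\qquad m_2=\operatorname{rank}F_{*p},$$ where $(e_i)$ is an orthonormal basis of $(\ker F_{*p})^\perp$, extended arbitrarily to smooth vector fields near $p$, and $\perp$ denotes the orthogonal projection onto $(\operatorname{range}F_{*p})^\perp$ (the value does not depend on the choices). For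 a section $V$ of $(\operatorname{range}F_*)^\perp$, let $A_VF_*X$ be minus the component of $\nabla^2_XV$ in $\operatorname{range}F_*$. The map $F$ is called pseudo-umbilical if there is $\lambda\in C^\infty(M_1)$ such that $$A_{H_2}F_*X=\lambda\,F_*X\qquad\text{for all }X\in\Gamma((\ker F_*)^\perp).\tag{1}$$ Proposition 3.1. The Riemannian map $F$ is pseudo-umbilical if and only if $$g_2\bigl((\nabla F_*)(X,Y),H_2\bigr)=g_1(X,Y)\,\|H_2\|^2\qquad\text{for all }X,Y\in\Gamma((\ker F_*)^\perp),$$ where $\|H_2\|^2=g_2(H_2,H_2)$. Moreover, every $\lambda\in C^\infty(M_1)$ satisfying (1) equals $\|H_2\|^2$. -/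

import Mathlib

open Bundle FiberBundle VectorField
open scoped Manifold ContDiff

noncomputable section

namespace RiemMap

section LeviCivita

variable {E : Type*} [NormedAddCommGroup E] [NormedSpace ℝ E]
  {H : Type*} [TopologicalSpace H] (I : ModelWithCorners ℝ E H)
  {M : Type*} [TopologicalSpace M] [ChartedSpace H M]
  [RiemannianBundle (fun x : M => TangentSpace I x)]

/-- The right-hand side of the Koszul formula: for the Levi-Civita connection `∇`,
`2 ⟪∇_X Y, Z⟫ = X⟪Y, Z⟫ + Y⟪Z, X⟫ - Z⟪X, Y⟫ + ⟪[X, Y], Z⟫ - ⟪[X, Z], Y⟫ - ⟪[Y, Z], X⟫`. -/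
def koszul (X Y Z : ∀ x : M, TangentSpace I x) (x : M) : ℝ :=
  mvfderiv I (fun y => inner ℝ (Y y) (Z y)) x (X x)
    + mvfderiv I (fun y => inner ℝ (Z y) (X y)) x (Y x)
    - mvfderiv I (fun y => inner ℝ (X y) (Y y)) x (Z x)
    + inner ℝ (mlieBracket I X Y x) (Z x)
    - inner ℝ (mlieBracket I X Z x) (Y x)
    - inner ℝ (mlieBracket I Y Z x) (X x)

variable [IsManifold I ∞ M]

lemma ext_of_inner {x : M} {A B : TangentSpace I x →L[ℝ] TangentSpace I x}
    (h : ∀ X Z : ∀ x : M, TangentSpace I x, MDiffAt (T% X) x → MDiffAt (T% Z) x →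
      inner ℝ (A (X x)) (Z x) = inner ℝ (B (X x)) (Z x)) : A = B := by
  refine ContinuousLinearMap.ext fun u => ext_inner_right ℝ fun w => ?_
  have := h (extend E u) (extend E w) (mdifferentiableAt_extend ..) (mdifferentiableAt_extend ..)
  simpa using this

variable [IsContMDiffRiemannianBundle I ∞ E (fun x : M => TangentSpace I x)]
  {X X' Y Y' Z Z' : ∀ x : M, TangentSpace I x} {f : M → ℝ} {x : M}

lemma mdiffAt_inner (hX : MDiffAt (T% X) x) (hY : MDiffAt (T% Y) x) :
    MDiffAt (fun y => inner ℝ (X y) (Y y)) x :=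
  MDifferentiableAt.inner_bundle (E := fun x : M => TangentSpace I x) (F := E) (IB := I)
    (b := fun y => y) hX hY

variable [FiniteDimensional ℝ E]

lemma koszul_add_left (hX : MDiffAt (T% X) x) (hX' : MDiffAt (T% X') x)
    (hY : MDiffAt (T% Y) x) (hZ : MDiffAt (T% Z) x) :
    koszul I (X + X') Y Z x = koszul I X Y Z x + koszul I X' Y Z x := by
  have : CompleteSpace E := FiniteDimensional.complete ℝ E
  simp only [koszul, Pi.add_apply, inner_add_left, inner_add_right,
    mlieBracket_add_left hX hX', map_add,
    mvfderiv_fun_add (mdiffAt_inner I hZ hX) (mdiffAt_inner I hZ hX'),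
    mvfderiv_fun_add (mdiffAt_inner I hX hY) (mdiffAt_inner I hX' hY), add_apply]
  ring

lemma koszul_add_mid (hX : MDiffAt (T% X) x)
    (hY : MDiffAt (T% Y) x) (hY' : MDiffAt (T% Y') x) (hZ : MDiffAt (T% Z) x) :
    koszul I X (Y + Y') Z x = koszul I X Y Z x + koszul I X Y' Z x := by
  have : CompleteSpace E := FiniteDimensional.complete ℝ E
  simp only [koszul, Pi.add_apply, inner_add_left, inner_add_right,
    mlieBracket_add_left hY hY', mlieBracket_add_right hY hY', map_add,
    mvfderiv_fun_add (mdiffAt_inner I hY hZ) (mdiffAt_inner I hY' hZ),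
    mvfderiv_fun_add (mdiffAt_inner I hX hY) (mdiffAt_inner I hX hY'), add_apply]
  ring

lemma koszul_add_right (hX : MDiffAt (T% X) x)
    (hY : MDiffAt (T% Y) x) (hZ : MDiffAt (T% Z) x) (hZ' : MDiffAt (T% Z') x) :
    koszul I X Y (Z + Z') x = koszul I X Y Z x + koszul I X Y Z' x := by
  have : CompleteSpace E := FiniteDimensional.complete ℝ E
  simp only [koszul, Pi.add_apply, inner_add_left, inner_add_right,
    mlieBracket_add_right hZ hZ', map_add,
    mvfderiv_fun_add (mdiffAt_inner I hY hZ) (mdiffAt_inner I hY hZ'),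
    mvfderiv_fun_add (mdiffAt_inner I hZ hX) (mdiffAt_inner I hZ' hX), add_apply]
  ring

lemma koszul_smul_left (hf : MDiffAt f x) (hX : MDiffAt (T% X) x)
    (hY : MDiffAt (T% Y) x) (hZ : MDiffAt (T% Z) x) :
    koszul I (f • X) Y Z x = f x * koszul I X Y Z x := by
  have : CompleteSpace E := FiniteDimensional.complete ℝ E
  simp only [koszul, Pi.smul_apply', real_inner_smul_left, real_inner_smul_right,
    mlieBracket_smul_left hf hX, map_smul, inner_add_left,
    mvfderiv_fun_mul hf (mdiffAt_inner I hZ hX),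
    mvfderiv_fun_mul hf (mdiffAt_inner I hX hY), add_apply, smul_apply, smul_eq_mul]
  rw [real_inner_comm (X x) (Z x)]
  ring

lemma koszul_smul_mid (hf : MDiffAt f x) (hX : MDiffAt (T% X) x)
    (hY : MDiffAt (T% Y) x) (hZ : MDiffAt (T% Z) x) :
    koszul I X (f • Y) Z x
      = f x * koszul I X Y Z x + 2 * (mvfderiv I f x (X x) * inner ℝ (Y x) (Z x)) := by
  have : CompleteSpace E := FiniteDimensional.complete ℝ E
  simp only [koszul, Pi.smul_apply', real_inner_smul_left, real_inner_smul_right,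
    mlieBracket_smul_left hf hY, mlieBracket_smul_right hf hY, map_smul, inner_add_left,
    mvfderiv_fun_mul hf (mdiffAt_inner I hY hZ),
    mvfderiv_fun_mul hf (mdiffAt_inner I hX hY), add_apply, smul_apply, smul_eq_mul]
  rw [real_inner_comm (Y x) (X x)]
  ring

lemma koszul_smul_right (hf : MDiffAt f x) (hX : MDiffAt (T% X) x)
    (hY : MDiffAt (T% Y) x) (hZ : MDiffAt (T% Z) x) :
    koszul I X Y (f • Z) x = f x * koszul I X Y Z x := by
  have : CompleteSpace E := FiniteDimensional.complete ℝ E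
  simp only [koszul, Pi.smul_apply', real_inner_smul_left, real_inner_smul_right,
    mlieBracket_smul_right hf hZ, map_smul, inner_add_left,
    mvfderiv_fun_mul hf (mdiffAt_inner I hY hZ),
    mvfderiv_fun_mul hf (mdiffAt_inner I hZ hX), add_apply, smul_apply, smul_eq_mul]
  rw [real_inner_comm (Z x) (Y x)]
  ring

instance finiteDimensional_tangentSpace (x : M) : FiniteDimensional ℝ (TangentSpace I x) :=
  inferInstanceAs (FiniteDimensional ℝ E)

variable {I} in
/-- For a vector field `Y` differentiable at `x`, half of the Koszul expression is tensorial in the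
other two arguments; this is the resulting bilinear form `(u, w) ↦ ⟪∇_u Y, w⟫` on `T_x M`. -/
def halfKoszul (Y : ∀ x : M, TangentSpace I x) (x : M) (hY : MDiffAt (T% Y) x) :
    TangentSpace I x →L[ℝ] TangentSpace I x →L[ℝ] ℝ :=
  TensorialAt.mkHom₂ (I := I) (F := E) (F' := E) (V := fun x : M => TangentSpace I x)
    (V' := fun x : M => TangentSpace I x) (fun X Z => (1 / 2 : ℝ) * koszul I X Y Z x) x
    (fun Z hZ =>
      { smul := fun hf hX => by
          rw [koszul_smul_left I hf hX hY hZ, smul_eq_mul]; ring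
        add := fun hX hX' => by
          rw [koszul_add_left I hX hX' hY hZ]; ring })
    (fun X hX =>
      { smul := fun hf hZ => by
          rw [koszul_smul_right I hf hX hY hZ, smul_eq_mul]; ring
        add := fun hZ hZ' => by
          rw [koszul_add_right I hX hY hZ hZ']; ring })

lemma halfKoszul_apply (hX : MDiffAt (T% X) x) (hY : MDiffAt (T% Y) x) (hZ : MDiffAt (T% Z) x) :
    halfKoszul Y x hY (X x) (Z x) = (1 / 2 : ℝ) * koszul I X Y Z x :=
  TensorialAt.mkHom₂_apply _ _ hX hZ

open Classical in
/-- The endomorphism `u ↦ ∇_u Y` of `T_x M` determined by the Koszul formula (with the value `0` if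
`Y` is not differentiable at `x`). -/
def leviCivitaFun (Y : ∀ x : M, TangentSpace I x) (x : M) :
    TangentSpace I x →L[ℝ] TangentSpace I x :=
  if hY : MDiffAt (T% Y) x then
    ∑ i, ((halfKoszul Y x hY).flip (stdOrthonormalBasis ℝ (TangentSpace I x) i)).smulRight
      (stdOrthonormalBasis ℝ (TangentSpace I x) i)
  else 0

lemma inner_leviCivitaFun' (hY : MDiffAt (T% Y) x) (u w : TangentSpace I x) :
    inner ℝ (leviCivitaFun I Y x u) w = halfKoszul Y x hY u w := by
  conv_rhs => rw [← (stdOrthonormalBasis ℝ (TangentSpace I x)).sum_repr' w]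
  simp only [leviCivitaFun, dif_pos hY, sum_apply, sum_inner, map_sum, map_smul,
    ContinuousLinearMap.smulRight_apply, real_inner_smul_left, ContinuousLinearMap.flip_apply,
    smul_eq_mul]
  exact Finset.sum_congr rfl fun i _ => mul_comm _ _

lemma inner_leviCivitaFun (hX : MDiffAt (T% X) x) (hY : MDiffAt (T% Y) x)
    (hZ : MDiffAt (T% Z) x) :
    inner ℝ (leviCivitaFun I Y x (X x)) (Z x) = (1 / 2 : ℝ) * koszul I X Y Z x := by
  rw [inner_leviCivitaFun' I hY, halfKoszul_apply I hX hY hZ]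

/-- The Levi-Civita connection of a Riemannian manifold: `leviCivita I Y x u` is `(∇_u Y)(x)`.
That it is torsion-free and metric is proved below. -/
def leviCivita : CovariantDerivative I E (fun x : M => TangentSpace I x) where
  toFun := leviCivitaFun I
  isCovariantDerivativeOnUniv :=
    { add := by
        intro Y Y' x hY hY' _
        have hs : MDiffAt (T% (Y + Y')) x := mdifferentiableAt_add_section hY hY'
        refine ext_of_inner I fun X Z hX hZ => ?_
        rw [inner_leviCivitaFun I hX hs hZ, add_apply, inner_add_left,
          inner_leviCivitaFun I hX hY hZ, inner_leviCivitaFun I hX hY' hZ,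
          koszul_add_mid I hX hY hY' hZ]
        ring
      leibniz := by
        intro Y f x hY hf _
        have hs : MDiffAt (T% (f • Y)) x := hf.smul_section hY
        refine ext_of_inner I fun X Z hX hZ => ?_
        rw [inner_leviCivitaFun I hX hs hZ, add_apply, inner_add_left, smul_apply,
          real_inner_smul_left, inner_leviCivitaFun I hX hY hZ,
          koszul_smul_mid I hf hX hY hZ, ContinuousLinearMap.smulRight_apply,
          real_inner_smul_left]
        ring }

lemma inner_leviCivita (hX : MDiffAt (T% X) x) (hY : MDiffAt (T% Y) x)
    (hZ : MDiffAt (T% Z) x) :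
    inner ℝ (leviCivita I Y x (X x)) (Z x) = (1 / 2 : ℝ) * koszul I X Y Z x :=
  inner_leviCivitaFun I hX hY hZ

/-- The Levi-Civita connection is torsion-free. -/
lemma leviCivita_torsion (hX : MDiffAt (T% X) x) (hY : MDiffAt (T% Y) x) :
    leviCivita I Y x (X x) - leviCivita I X x (Y x) = mlieBracket I X Y x := by
  refine ext_inner_right ℝ fun w => ?_
  have hZ : MDiffAt (T% (extend E w)) x := mdifferentiableAt_extend ..
  rw [inner_sub_left]
  rw [← extend_apply_self (F := E) (E := fun x : M => TangentSpace I x) w]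
  rw [inner_leviCivita I hX hY hZ, inner_leviCivita I hY hX hZ]
  simp only [koszul, mlieBracket_swap_apply (V := Y) (W := X), inner_neg_left]
  simp only [real_inner_comm]
  ring

/-- The Levi-Civita connection is compatible with the metric. -/
lemma leviCivita_metric (hX : MDiffAt (T% X) x) (hY : MDiffAt (T% Y) x)
    (hZ : MDiffAt (T% Z) x) :
    mvfderiv I (fun y => inner ℝ (Y y) (Z y)) x (X x)
      = inner ℝ (leviCivita I Y x (X x)) (Z x) + inner ℝ (Y x) (leviCivita I Z x (X x)) := by
  rw [real_inner_comm _ (Y x), inner_leviCivita I hX hY hZ, inner_leviCivita I hX hZ hY]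
  simp only [koszul, mlieBracket_swap_apply (V := Z) (W := Y), inner_neg_left]
  simp only [real_inner_comm]
  ring

end LeviCivita
section Maps

variable {E₁ : Type*} [NormedAddCommGroup E₁] [NormedSpace ℝ E₁] [FiniteDimensional ℝ E₁]
  {B₁ : Type*} [TopologicalSpace B₁] (I₁ : ModelWithCorners ℝ E₁ B₁)
  {M₁ : Type*} [TopologicalSpace M₁] [ChartedSpace B₁ M₁] [IsManifold I₁ ∞ M₁]
  [RiemannianBundle (fun x : M₁ => TangentSpace I₁ x)]
  [IsContMDiffRiemannianBundle I₁ ∞ E₁ (fun x : M₁ => TangentSpace I₁ x)]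
  {E₂ : Type*} [NormedAddCommGroup E₂] [NormedSpace ℝ E₂] [FiniteDimensional ℝ E₂]
  {B₂ : Type*} [TopologicalSpace B₂] (I₂ : ModelWithCorners ℝ E₂ B₂)
  {M₂ : Type*} [TopologicalSpace M₂] [ChartedSpace B₂ M₂] [IsManifold I₂ ∞ M₂]
  [RiemannianBundle (fun x : M₂ => TangentSpace I₂ x)]
  [IsContMDiffRiemannianBundle I₂ ∞ E₂ (fun x : M₂ => TangentSpace I₂ x)]
  (F : M₁ → M₂)

/-- The horizontal space `(ker F_{*p})ᗮ` at `p`. -/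
def horizontalSpace (p : M₁) : Submodule ℝ (TangentSpace I₁ p) :=
  (LinearMap.ker (mfderiv I₁ I₂ F p).toLinearMap)ᗮ

/-- The range `F_*(T_p M₁)` of the differential at `p`, a subspace of `T_{F(p)} M₂`. -/
def rangeSpace (p : M₁) : Submodule ℝ (TangentSpace I₂ (F p)) :=
  LinearMap.range (mfderiv I₁ I₂ F p).toLinearMap

/-- `F` is a Riemannian map: it is smooth, and at every point its differential maps
`(ker F_*)ᗮ` isometrically onto `range F_*` (surjectivity is automatic). -/
structure IsRiemannianMap : Prop where
  contMDiff : ContMDiff I₁ I₂ ∞ F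
  inner_eq : ∀ p : M₁, ∀ x ∈ horizontalSpace I₁ I₂ F p, ∀ y ∈ horizontalSpace I₁ I₂ F p,
    inner ℝ (mfderiv I₁ I₂ F p x) (mfderiv I₁ I₂ F p y) = inner ℝ x y

/-- `X` is a smooth horizontal vector field on `M₁`, i.e. `X ∈ Γ((ker F_*)ᗮ)`. -/
structure IsHorizontalField (X : ∀ p : M₁, TangentSpace I₁ p) : Prop where
  contMDiff : ContMDiff I₁ I₁.tangent ∞ (fun p => (⟨p, X p⟩ : TangentBundle I₁ M₁))
  mem : ∀ p, X p ∈ horizontalSpace I₁ I₂ F p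

/-- The vector field `F_* X` along `F`. -/
def push (X : ∀ p : M₁, TangentSpace I₁ p) (p : M₁) : TangentSpace I₂ (F p) :=
  mfderiv I₁ I₂ F p (X p)

/-- The pullback of the Levi-Civita connection of `M₂` along `F`, applied to a vector field `V`
along `F`: `pullbackConnection I₁ I₂ F V p x` is `(∇_x V)(p)`.
In the local frame `(s_a)` of `TM₂` near `F p` that is constant in the trivialization at `F p`,
write `V = ∑ v^a (s_a ∘ F)`; then `∇_x V = ∑ dv^a(x) s_a + ∑ v^a(p) ∇_{F_* x} s_a`. The first
summand below is the first sum, and `extend E₂ (V p)` is the local section `∑ v^a(p) s_a`. -/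
def pullbackConnection (V : ∀ p : M₁, TangentSpace I₂ (F p)) (p : M₁) :
    TangentSpace I₁ p →L[ℝ] TangentSpace I₂ (F p) :=
  ((trivializationAt E₂ (fun y : M₂ => TangentSpace I₂ y) (F p)).symmL ℝ (F p)).comp
      (mvfderiv I₁ (fun q =>
        (trivializationAt E₂ (fun y : M₂ => TangentSpace I₂ y) (F p) ⟨F q, V q⟩).2) p)
    + (leviCivita I₂ (extend E₂ (V p)) (F p)).comp (mfderiv I₁ I₂ F p)

/-- The second fundamental form `(∇F_*)(X, Y) = ∇_X (F_* Y) - F_*(∇_X Y)` of `F`. -/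
def secondFundamentalForm (X Y : ∀ p : M₁, TangentSpace I₁ p) (p : M₁) :
    TangentSpace I₂ (F p) :=
  pullbackConnection I₁ I₂ F (push I₁ I₂ F Y) p (X p)
    - mfderiv I₁ I₂ F p (leviCivita I₁ Y p (X p))

/-- The mean curvature vector field `H₂` of the distribution `range F_*`, a vector field along `F`:
`H₂(p) = (1 / m₂) ∑ (∇_{e_i} F_* e_i)ᗮ`, where `m₂` is the rank of `F` at `p`, `(e_i)` is an
orthonormal basis of `(ker F_{*p})ᗮ`, and `ᗮ` is the projection onto `(range F_{*p})ᗮ`.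
Each summand is independent of the extension of `e_i` to a vector field near `p`, since
`(∇_X F_*(f Y))ᗮ = f (∇_X F_* Y)ᗮ`, so that any extension may be used. -/
def meanCurvature (p : M₁) : TangentSpace I₂ (F p) :=
  (Module.finrank ℝ (rangeSpace I₁ I₂ F p) : ℝ)⁻¹ •
    ∑ i, (rangeSpace I₁ I₂ F p)ᗮ.starProjection
      (pullbackConnection I₁ I₂ F
        (push I₁ I₂ F
          (extend E₁ (stdOrthonormalBasis ℝ (horizontalSpace I₁ I₂ F p) i : TangentSpace I₁ p)))
        p (stdOrthonormalBasis ℝ (horizontalSpace I₁ I₂ F p) i : TangentSpace I₁ p))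

/-- The vector field `A_V F_* X` along `F`, for a section `V` of `(range F_*)ᗮ`: minus the
component of `∇_X V` in `range F_*`. -/
def shapeOperator (V : ∀ p : M₁, TangentSpace I₂ (F p)) (X : ∀ p : M₁, TangentSpace I₁ p)
    (p : M₁) : TangentSpace I₂ (F p) :=
  -(rangeSpace I₁ I₂ F p).starProjection (pullbackConnection I₁ I₂ F V p (X p))

/-- `lam ∈ C^∞(M₁)` and `A_{H₂} F_* X = lam F_* X` for all `X ∈ Γ((ker F_*)ᗮ)`. -/
structure IsPseudoUmbilicalWith (lam : M₁ → ℝ) : Prop where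
  contMDiff : ContMDiff I₁ 𝓘(ℝ, ℝ) ∞ lam
  shape_eq : ∀ X : ∀ p : M₁, TangentSpace I₁ p, IsHorizontalField I₁ I₂ F X → ∀ p : M₁,
    shapeOperator I₁ I₂ F (meanCurvature I₁ I₂ F) X p = lam p • push I₁ I₂ F X p

/-- `F` is pseudo-umbilical. -/
def IsPseudoUmbilical : Prop := ∃ lam : M₁ → ℝ, IsPseudoUmbilicalWith I₁ I₂ F lam

end Maps

end RiemMap

end

/-!
The pullback connection is compatible with the metric of `M₂`, so differentiating the identity
`⟪H₂, F_* Y⟫ = 0` along `X` gives the Weingarten relation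
`⟪A_{H₂} F_* X, F_* Y⟫ = ⟪(∇F_*)(X, Y), H₂⟫` for the horizontal fields `X`, `Y`
(`RiemMap.inner_shapeOperator_meanCurvature`). As `F_*` is isometric on horizontal vectors,
`A_{H₂} F_* X = λ F_* X` is therefore equivalent to `⟪(∇F_*)(X, Y), H₂⟫ = λ ⟪X, Y⟫`. The trace of
this over an orthonormal basis of `(ker F_{*p})ᗮ` is `m₂ ‖H₂‖² = m₂ λ`, and `m₂ > 0`
(`RiemMap.eq_norm_sq_of_inner_secondFundamentalForm`).

The Weingarten relation presupposes that `H₂` is smooth along `F`, which is also what makes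
`‖H₂‖²` an admissible `λ` in the converse (`RiemMap.smoothAlong_meanCurvature`). The definition of
`H₂` chooses an unrelated basis at each point, so it is rewritten in smooth orthonormal frames
`(f_a)` of `TM₁` and `(s_c)` of `TM₂`, obtained by Gram-Schmidt. In the frame `(s_c)` the pullback connection is
given by the usual formula (`RiemMap.pullbackConnection_eq_sum`) and preserves smoothness, since the
connection coefficients are given by the Koszul formula. For a Riemannian map `F_*ᵀ F_*` and
`F_* F_*ᵀ` are the projections onto `(ker F_*)ᗮ` and `range F_*`, and the trace of the former is the
rank; hence these are smooth without any appeal to the constant rank theorem, and so is `H₂`.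
The horizontal projection of a vector field `Y` cut off by a bump function provides the global
horizontal fields; it has the same image under `F_*` as `Y`.
-/

noncomputable section

namespace RiemMap

/-! ### Smooth orthonormal frames -/

section Frames

open InnerProductSpace Module

variable {E : Type*} [NormedAddCommGroup E] [NormedSpace ℝ E]
  {H : Type*} [TopologicalSpace H] (I : ModelWithCorners ℝ E H)
  {M : Type*} [TopologicalSpace M] [ChartedSpace H M]
  [IsManifold I ∞ M] [RiemannianBundle (fun x : M => TangentSpace I x)]

/-- A smooth orthonormal frame of `TM` over the open set `U`. The index type has `dim M` elements,
so that orthonormality makes the frame a basis of each tangent space. -/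
structure IsOrthonormalFrameOn (f : Fin (finrank ℝ E) → ∀ x : M, TangentSpace I x) (U : Set M) :
    Prop where
  isOpen : IsOpen U
  contMDiffOn : ∀ i, CMDiff[U] ∞ (T% (f i))
  orthonormal : ∀ x ∈ U, Orthonormal ℝ (f · x)

variable {I} {f : Fin (finrank ℝ E) → ∀ x : M, TangentSpace I x} {U : Set M} {x : M}

lemma IsOrthonormalFrameOn.mdifferentiableAt (hf : IsOrthonormalFrameOn I f U) (hx : x ∈ U)
    (i : Fin (finrank ℝ E)) : MDiffAt (T% (f i)) x :=
  ((hf.contMDiffOn i).contMDiffAt (hf.isOpen.mem_nhds hx)).mdifferentiableAt (by simp)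

lemma IsOrthonormalFrameOn.mono (hf : IsOrthonormalFrameOn I f U) {V : Set M} (hV : IsOpen V)
    (hVU : V ⊆ U) : IsOrthonormalFrameOn I f V where
  isOpen := hV
  contMDiffOn i := (hf.contMDiffOn i).mono hVU
  orthonormal x hx := hf.orthonormal x (hVU hx)

variable [FiniteDimensional ℝ E]

lemma IsOrthonormalFrameOn.exists_basis (hf : IsOrthonormalFrameOn I f U) (hx : x ∈ U) :
    ∃ b : OrthonormalBasis (Fin (finrank ℝ E)) ℝ (TangentSpace I x), ∀ i, b i = f i x := by
  have hc : Fintype.card (Fin (finrank ℝ E)) = finrank ℝ (TangentSpace I x) := by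
    rw [Fintype.card_fin]; rfl
  have hspan := (hf.orthonormal x hx).linearIndependent.span_eq_top_of_card_eq_finrank' hc
  exact ⟨OrthonormalBasis.mk (hf.orthonormal x hx) hspan.ge, fun i => by simp⟩

lemma IsOrthonormalFrameOn.sum_inner_smul (hf : IsOrthonormalFrameOn I f U) (hx : x ∈ U)
    (v : TangentSpace I x) : ∑ i, inner ℝ v (f i x) • f i x = v := by
  obtain ⟨b, hb⟩ := hf.exists_basis hx
  simp only [← hb]
  simpa only [real_inner_comm] using b.sum_repr' v

lemma IsOrthonormalFrameOn.sum_inner_mul_inner (hf : IsOrthonormalFrameOn I f U) (hx : x ∈ U)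
    (v w : TangentSpace I x) :
    ∑ i, inner ℝ v (f i x) * inner ℝ w (f i x) = inner ℝ v w := by
  conv_rhs => rw [← hf.sum_inner_smul hx w]
  simp only [inner_sum, real_inner_smul_right]
  exact Finset.sum_congr rfl fun i _ => mul_comm _ _

variable [IsContMDiffRiemannianBundle I ∞ E (fun x : M => TangentSpace I x)]

lemma contMDiffOn_inner {X Y : ∀ x : M, TangentSpace I x} (hX : CMDiff[U] ∞ (T% X))
    (hY : CMDiff[U] ∞ (T% Y)) : CMDiff[U] ∞ (fun x => inner ℝ (X x) (Y x)) :=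
  ContMDiffOn.inner_bundle (E := fun x : M => TangentSpace I x) (F := E) (IB := I)
    (b := fun y => y) hX hY

lemma contMDiffOn_gramSchmidt {n : ℕ} {s : Fin n → ∀ x : M, TangentSpace I x}
    (hs : ∀ i, CMDiff[U] ∞ (T% (s i))) (hli : ∀ x ∈ U, LinearIndependent ℝ (s · x)) (i : Fin n) :
    CMDiff[U] ∞ (T% (fun x => gramSchmidt ℝ (s · x) i)) := by
  induction i using WellFoundedLT.induction with
  | _ i ih =>
    have hc : ∀ j ∈ Finset.Iio i, CMDiff[U] ∞ (T% (fun x =>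
        (inner ℝ (gramSchmidt ℝ (s · x) j) (s i x)
          / inner ℝ (gramSchmidt ℝ (s · x) j) (gramSchmidt ℝ (s · x) j))
          • gramSchmidt ℝ (s · x) j)) := by
      intro j hj
      have hg := ih j (Finset.mem_Iio.1 hj)
      refine ContMDiffOn.smul_section ?_ hg
      refine (contMDiffOn_inner hg (hs i)).div₀ (contMDiffOn_inner hg hg) fun x hx => ?_
      exact inner_self_ne_zero.2 (gramSchmidt_ne_zero j (hli x hx))
    refine ((hs i).sub_section (.sum_section hc)).congr fun x hx => ?_
    congr 1
    have := gramSchmidt_def'' ℝ (s · x) i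
    simp only [← real_inner_self_eq_norm_sq, RCLike.ofReal_real_eq_id, id] at this
    exact eq_sub_of_add_eq this.symm

/-- Around each point there is a smooth orthonormal frame, obtained by applying the Gram-Schmidt
process to the frame of a trivialization. -/
lemma exists_isOrthonormalFrameOn (x : M) :
    ∃ (U : Set M) (f : Fin (finrank ℝ E) → ∀ x : M, TangentSpace I x),
      x ∈ U ∧ IsOrthonormalFrameOn I f U := by
  set e := trivializationAt E (fun x : M => TangentSpace I x) x
  set b := Module.finBasis ℝ E
  have hs : IsLocalFrameOn I E ∞ (e.localFrame b) e.baseSet :=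
    e.isLocalFrameOn_localFrame_baseSet ..
  refine ⟨e.baseSet, fun i x => gramSchmidtNormed ℝ (e.localFrame b · x) i,
    mem_baseSet_trivializationAt' x, e.open_baseSet, fun i => ?_, fun x hx =>
      gramSchmidtNormed_orthonormal (hs.linearIndependent hx)⟩
  have hg := contMDiffOn_gramSchmidt hs.contMDiffOn (fun x hx => hs.linearIndependent hx) i
  refine ContMDiffOn.smul_section (f := fun x => (‖gramSchmidt ℝ (e.localFrame b · x) i‖)⁻¹) ?_ hg
  have hpos : ∀ x ∈ e.baseSet, gramSchmidt ℝ (e.localFrame b · x) i ≠ 0 := fun x hx =>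
    gramSchmidt_ne_zero i (hs.linearIndependent hx)
  refine ContMDiffOn.inv₀ (fun x hx => ?_) fun x hx => norm_ne_zero_iff.2 (hpos x hx)
  simp only [norm_eq_sqrt_real_inner]
  exact (Real.contDiffAt_sqrt (inner_self_ne_zero.2 (hpos x hx))).contMDiffAt.comp_contMDiffWithinAt
    x (contMDiffOn_inner hg hg x hx)

end Frames

section

variable {E : Type*} [NormedAddCommGroup E] [NormedSpace ℝ E]
  {H : Type*} [TopologicalSpace H] {I : ModelWithCorners ℝ E H}
  {M : Type*} [TopologicalSpace M] [ChartedSpace H M] [IsManifold I ∞ M] {U : Set M}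

lemma contMDiffOn_mvfderiv_apply {g : M → ℝ} {X : ∀ x : M, TangentSpace I x} (hU : IsOpen U)
    (hg : CMDiff[U] ∞ g) (hX : CMDiff[U] ∞ (T% X)) :
    CMDiff[U] ∞ (fun x => mvfderiv I g x (X x)) := by
  have := (hg.contMDiffOn_tangentMapWithin (m := ∞) (by simp) hU.uniqueMDiffOn).comp hX
    (fun x hx => hx)
  have h2 := (contMDiff_snd_tangentBundle_modelSpace ℝ 𝓘(ℝ, ℝ) (n := ∞)).comp_contMDiffOn this
  refine h2.congr fun x hx => ?_
  change mfderiv I 𝓘(ℝ, ℝ) g x (X x) = mfderivWithin I 𝓘(ℝ, ℝ) g U x (X x)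
  rw [mfderivWithin_of_isOpen hU hx]

end

/-! ### The Levi-Civita connection in a trivialization -/

section Christoffel

open Module Topology

variable {E : Type*} [NormedAddCommGroup E] [NormedSpace ℝ E]
  {H : Type*} [TopologicalSpace H] {I : ModelWithCorners ℝ E H}
  {M : Type*} [TopologicalSpace M] [ChartedSpace H M]
  {G : Type*} [NormedAddCommGroup G] [NormedSpace ℝ G]

lemma mvfderiv_congr {g g' : M → G} {x : M} (h : g =ᶠ[𝓝 x] g') :
    mvfderiv I g x = mvfderiv I g' x := by
  ext v
  exact DFunLike.congr_fun (h.mfderiv_eq (I := I) (I' := 𝓘(ℝ, G))) v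

lemma mdifferentiableAt_finsetSum {ι : Type*} {t : Finset ι} {g : ι → M → G} {x : M}
    (hg : ∀ i ∈ t, MDiffAt (g i) x) : MDiffAt (fun y => ∑ i ∈ t, g i y) x := by
  classical
  induction t using Finset.induction_on with
  | empty => simpa using mdifferentiableAt_const
  | insert a t ha ih =>
    simp only [Finset.sum_insert ha]
    exact (hg a (by simp)).add (ih fun i hi => hg i (by simp [hi]))

lemma mvfderiv_finsetSum {ι : Type*} {t : Finset ι} {g : ι → M → G} {x : M}
    (hg : ∀ i ∈ t, MDiffAt (g i) x) :
    mvfderiv I (fun y => ∑ i ∈ t, g i y) x = ∑ i ∈ t, mvfderiv I (g i) x := by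
  classical
  induction t using Finset.induction_on with
  | empty => simpa using mvfderiv_const (0 : G)
  | insert a t ha ih =>
    have hg' : ∀ i ∈ t, MDiffAt (g i) x := fun i hi => hg i (by simp [hi])
    simp only [Finset.sum_insert ha]
    rw [mvfderiv_fun_add (hg a (by simp)) (mdifferentiableAt_finsetSum hg'), ih hg']

variable [IsManifold I ∞ M]

variable (I) in
/-- The derivative at `x` of the vector field `Y` read in the trivialization of `TM` at `x`, that
is, the covariant derivative of `Y` for the flat connection of that trivialization. -/
def trivDeriv (Y : ∀ x : M, TangentSpace I x) (x : M) : TangentSpace I x →L[ℝ] TangentSpace I x :=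
  ((trivializationAt E (fun y : M => TangentSpace I y) x).symmL ℝ x).comp
    (mvfderiv I (fun z => (trivializationAt E (fun y : M => TangentSpace I y) x ⟨z, Y z⟩).2) x)

variable {Y Y' : ∀ x : M, TangentSpace I x} {x : M} {f : M → ℝ}

lemma mdifferentiableAt_trivialization_snd (hY : MDiffAt (T% Y) x) :
    MDiffAt (fun z => (trivializationAt E (fun y : M => TangentSpace I y) x ⟨z, Y z⟩).2) x :=
  mdifferentiableAt_section .. |>.1 hY

lemma trivDeriv_add (hY : MDiffAt (T% Y) x) (hY' : MDiffAt (T% Y') x) :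
    trivDeriv I (Y + Y') x = trivDeriv I Y x + trivDeriv I Y' x := by
  set e := trivializationAt E (fun y : M => TangentSpace I y) x with he
  have h : (fun z => (e ⟨z, (Y + Y') z⟩).2) =ᶠ[𝓝 x] fun z => (e ⟨z, Y z⟩).2 + (e ⟨z, Y' z⟩).2 := by
    filter_upwards [e.open_baseSet.mem_nhds (mem_baseSet_trivializationAt' x)] with z hz
    exact (e.linear ℝ hz).map_add _ _
  rw [trivDeriv, mvfderiv_congr h, mvfderiv_fun_add (mdifferentiableAt_trivialization_snd hY)
    (mdifferentiableAt_trivialization_snd hY'), ContinuousLinearMap.comp_add]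
  rfl

lemma trivDeriv_smul (hf : MDiffAt f x) (hY : MDiffAt (T% Y) x) :
    trivDeriv I (f • Y) x = f x • trivDeriv I Y x + (mvfderiv I f x).smulRight (Y x) := by
  set e := trivializationAt E (fun y : M => TangentSpace I y) x with he
  have hx : x ∈ e.baseSet := mem_baseSet_trivializationAt' x
  have h : (fun z => (e ⟨z, (f • Y) z⟩).2) =ᶠ[𝓝 x] fun z => f z • (e ⟨z, Y z⟩).2 := by
    filter_upwards [e.open_baseSet.mem_nhds hx] with z hz
    exact (e.linear ℝ hz).map_smul _ _
  rw [trivDeriv, mvfderiv_congr h, mvfderiv_fun_smul hf (mdifferentiableAt_trivialization_snd hY)]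
  ext u
  have := e.symm_apply_apply_mk hx (Y x)
  rw [← e.symmL_apply (R := ℝ) hx] at this
  simp [trivDeriv, ← he, this]

lemma trivDeriv_extend (v : TangentSpace I x) : trivDeriv I (extend E v) x = 0 := by
  set e := trivializationAt E (fun y : M => TangentSpace I y) x with he
  have h : (fun z => (e ⟨z, extend E v z⟩).2) =ᶠ[𝓝 x] fun _ => (e ⟨x, v⟩).2 := by
    filter_upwards [e.open_baseSet.mem_nhds (mem_baseSet_trivializationAt' x)] with z hz
    simp [extend, ← he, hz]
  rw [trivDeriv, mvfderiv_congr h, mvfderiv_const, ContinuousLinearMap.comp_zero]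

variable [RiemannianBundle (fun x : M => TangentSpace I x)]
  [IsContMDiffRiemannianBundle I ∞ E (fun x : M => TangentSpace I x)]
  [FiniteDimensional ℝ E]

/-- The Christoffel tensor: in the trivialization of `TM` at `x`, the Levi-Civita connection at `x`
is the flat connection plus a term that is linear in the value of the vector field at `x`. -/
lemma exists_leviCivita_eq_trivDeriv_add (x : M) :
    ∃ Γ : TangentSpace I x →L[ℝ] TangentSpace I x →L[ℝ] TangentSpace I x,
      (∀ v, leviCivita I (extend E v) x = Γ v) ∧
      ∀ Y : (∀ x : M, TangentSpace I x), MDiffAt (T% Y) x →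
        leviCivita I Y x = trivDeriv I Y x + Γ (Y x) := by
  have hΦ : TensorialAt I E (fun Y : (∀ x : M, TangentSpace I x) =>
      leviCivita I Y x - trivDeriv I Y x) x :=
    { smul := fun hf hY => by
        simp only [(leviCivita I).isCovariantDerivativeOnUniv.leibniz hY hf, trivDeriv_smul hf hY]
        module
      add := fun hY hY' => by
        simp only [(leviCivita I).isCovariantDerivativeOnUniv.add hY hY', trivDeriv_add hY hY']
        abel }
  refine ⟨TensorialAt.mkHom _ x hΦ, fun v => ?_, fun Y hY => ?_⟩
  · rw [TensorialAt.mkHom_apply_eq_extend, trivDeriv_extend, sub_zero]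
  · rw [TensorialAt.mkHom_apply hΦ hY]; abel

end Christoffel

/-! ### The pullback connection in an orthonormal frame -/

section Pullback

open Module Topology

variable {E₁ : Type*} [NormedAddCommGroup E₁] [NormedSpace ℝ E₁]
  {B₁ : Type*} [TopologicalSpace B₁] {I₁ : ModelWithCorners ℝ E₁ B₁}
  {M₁ : Type*} [TopologicalSpace M₁] [ChartedSpace B₁ M₁]
  {E₂ : Type*} [NormedAddCommGroup E₂] [NormedSpace ℝ E₂] [FiniteDimensional ℝ E₂]
  {B₂ : Type*} [TopologicalSpace B₂] {I₂ : ModelWithCorners ℝ E₂ B₂}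
  {M₂ : Type*} [TopologicalSpace M₂] [ChartedSpace B₂ M₂] [IsManifold I₂ ∞ M₂]
  [RiemannianBundle (fun x : M₂ => TangentSpace I₂ x)]
  [IsContMDiffRiemannianBundle I₂ ∞ E₂ (fun x : M₂ => TangentSpace I₂ x)]
  {F : M₁ → M₂} {V V' W : ∀ p : M₁, TangentSpace I₂ (F p)} {p : M₁}
  {s : Fin (finrank ℝ E₂) → ∀ y : M₂, TangentSpace I₂ y} {U : Set M₂}

lemma pullbackConnection_congr (h : ∀ᶠ q in 𝓝 p, V q = V' q) :
    pullbackConnection I₁ I₂ F V p = pullbackConnection I₁ I₂ F V' p := by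
  rw [pullbackConnection, pullbackConnection, h.self_of_nhds,
    mvfderiv_congr (g' := fun q =>
      (trivializationAt E₂ (fun y : M₂ => TangentSpace I₂ y) (F p) ⟨F q, V' q⟩).2)]
  filter_upwards [h] with q hq
  rw [hq]

/-- The pullback connection in an orthonormal frame `(s_c)`: if `V = ∑ v_c (s_c ∘ F)`, then
`∇_x V = ∑ dv_c(x) s_c + v_c ∇_{F_* x} s_c`. -/
lemma pullbackConnection_eq_sum (hs : IsOrthonormalFrameOn I₂ s U) (hp : F p ∈ U)
    (hF : MDiffAt F p) (hV : ∀ c, MDiffAt (fun q => inner ℝ (V q) (s c (F q))) p)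
    (x : TangentSpace I₁ p) :
    pullbackConnection I₁ I₂ F V p x =
      ∑ c, (mvfderiv I₁ (fun q => inner ℝ (V q) (s c (F q))) p x • s c (F p)
        + (inner ℝ (V p) (s c (F p)) : ℝ) •
            leviCivita I₂ (s c) (F p) (mfderiv I₁ I₂ F p x)) := by
  obtain ⟨Γ, hΓe, hΓ⟩ := exists_leviCivita_eq_trivDeriv_add (I := I₂) (F p)
  set e := trivializationAt E₂ (fun y : M₂ => TangentSpace I₂ y) (F p) with he
  have hb : F p ∈ e.baseSet := mem_baseSet_trivializationAt' (F p)
  have hev : (fun q => (e ⟨F q, V q⟩).2) =ᶠ[𝓝 p]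
      fun q => ∑ c, (inner ℝ (V q) (s c (F q)) : ℝ) • (e ⟨F q, s c (F q)⟩).2 := by
    filter_upwards [hF.continuousAt.preimage_mem_nhds (e.open_baseSet.mem_nhds hb),
      hF.continuousAt.preimage_mem_nhds (hs.isOpen.mem_nhds hp)] with q hq hq'
    conv_lhs => rw [← hs.sum_inner_smul hq' (V q)]
    change (IsLinearMap.mk' _ (e.linear ℝ hq)) (∑ c, _)
      = ∑ c, _ • (IsLinearMap.mk' _ (e.linear ℝ hq)) _
    simp only [map_sum, map_smul]
  have hsd : ∀ c, MDiffAt (fun z => (e ⟨z, s c z⟩).2) (F p) := fun c =>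
    mdifferentiableAt_trivialization_snd (hs.mdifferentiableAt hp c)
  have hsF : ∀ c, MDiffAt (fun q => (e ⟨F q, s c (F q)⟩).2) p := fun c => (hsd c).comp p hF
  have hd : ∀ c, mvfderiv I₁ (fun q => (e ⟨F q, s c (F q)⟩).2) p x
      = mvfderiv I₂ (fun z => (e ⟨z, s c z⟩).2) (F p) (mfderiv I₁ I₂ F p x) := fun c =>
    mfderiv_comp_apply p (hsd c) hF x
  have hsum := mvfderiv_finsetSum (I := I₁) (t := Finset.univ) (x := p)
    (g := fun c q => (inner ℝ (V q) (s c (F q)) : ℝ) • (e ⟨F q, s c (F q)⟩).2)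
    fun c _ => (hV c).smul (hsF c)
  have hΓV : Γ (V p) = ∑ c, (inner ℝ (V p) (s c (F p)) : ℝ) • Γ (s c (F p)) := by
    conv_lhs => rw [← hs.sum_inner_smul hp (V p)]
    simp only [map_sum, map_smul]
  have hself : ∀ v : TangentSpace I₂ (F p), e.symmL ℝ (F p) (e ⟨F p, v⟩).2 = v := fun v => by
    rw [e.symmL_apply hb, e.symm_apply_apply_mk hb]
  rw [pullbackConnection, mvfderiv_congr hev, hsum, hΓe, hΓV, add_apply,
    ContinuousLinearMap.comp_apply, ContinuousLinearMap.comp_apply, sum_apply, sum_apply, map_sum,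
    ← Finset.sum_add_distrib]
  refine Finset.sum_congr rfl fun c _ => ?_
  rw [hΓ _ (hs.mdifferentiableAt hp c), trivDeriv]
  simp only [← he]
  rw [mvfderiv_fun_smul (hV c) (hsF c)]
  simp only [add_apply, smul_apply, ContinuousLinearMap.smulRight_apply, map_add, map_smul, hd,
    hself, ContinuousLinearMap.comp_apply]
  module

end Pullback

/-! ### Linear maps that are isometric on the orthogonal complement of their kernel -/

section LinearAlgebra

open Module

variable {V₁ V₂ : Type*} [NormedAddCommGroup V₁] [InnerProductSpace ℝ V₁] [FiniteDimensional ℝ V₁]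
  [NormedAddCommGroup V₂] [InnerProductSpace ℝ V₂]
  {A : V₁ →ₗ[ℝ] V₂} {ι : Type*} [Fintype ι]

lemma map_starProjection_orthogonal_ker (A : V₁ →ₗ[ℝ] V₂) (u : V₁) :
    A ((LinearMap.ker A)ᗮ.starProjection u) = A u := by
  have h : u - (LinearMap.ker A)ᗮ.starProjection u ∈ LinearMap.ker A := by
    have := Submodule.sub_starProjection_mem_orthogonal (K := (LinearMap.ker A)ᗮ) u
    rwa [Submodule.orthogonal_orthogonal] at this
  rw [LinearMap.mem_ker, map_sub, sub_eq_zero] at h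
  exact h.symm

lemma finrank_range_eq_finrank_orthogonal_ker (A : V₁ →ₗ[ℝ] V₂) :
    finrank ℝ (LinearMap.range A) = finrank ℝ (LinearMap.ker A)ᗮ := by
  have h1 := LinearMap.finrank_range_add_finrank_ker A
  have h2 := Submodule.finrank_add_finrank_orthogonal (LinearMap.ker A)
  omega

lemma starProjection_eq_sum_orthonormalBasis {K : Submodule ℝ V₁} (e : OrthonormalBasis ι ℝ K)
    (u : V₁) : K.starProjection u = ∑ i, (inner ℝ (e i : V₁) u : ℝ) • (e i : V₁) := by
  rw [Submodule.starProjection_apply, e.orthogonalProjectionOnto_apply_eq_sum]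
  simp

variable [FiniteDimensional ℝ V₂] (hA : ∀ x ∈ (LinearMap.ker A)ᗮ, ∀ y ∈ (LinearMap.ker A)ᗮ,
  inner ℝ (A x) (A y) = inner ℝ x y)

include hA

lemma inner_starProjection_orthogonal_ker (u v : V₁) :
    inner ℝ ((LinearMap.ker A)ᗮ.starProjection u) v = inner ℝ (A u) (A v) := by
  rw [← map_starProjection_orthogonal_ker A u, ← map_starProjection_orthogonal_ker A v,
    hA _ (Submodule.starProjection_apply_mem _ _) _ (Submodule.starProjection_apply_mem _ _)]
  rw [Submodule.inner_starProjection_left_eq_right, Submodule.inner_starProjection_left_eq_right,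
    Submodule.starProjection_eq_self_iff.2 (Submodule.starProjection_apply_mem _ _)]

/-- The projection onto `(ker A)ᗮ` is `Aᵀ A`, written in an orthonormal basis. -/
lemma starProjection_orthogonal_ker_eq_sum (f : OrthonormalBasis ι ℝ V₁) (u : V₁) :
    (LinearMap.ker A)ᗮ.starProjection u = ∑ b, (inner ℝ (A u) (A (f b)) : ℝ) • f b := by
  rw [← f.sum_repr' ((LinearMap.ker A)ᗮ.starProjection u)]
  refine Finset.sum_congr rfl fun b _ => ?_
  rw [real_inner_comm, inner_starProjection_orthogonal_ker hA]

/-- The projection onto `range A` is `A Aᵀ`, written in an orthonormal basis. -/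
lemma starProjection_range_eq_sum (f : OrthonormalBasis ι ℝ V₁) (w : V₂) :
    (LinearMap.range A).starProjection w = ∑ a, (inner ℝ w (A (f a)) : ℝ) • A (f a) := by
  refine (Submodule.eq_starProjection_of_mem_of_inner_eq_zero ?_ ?_)
  · exact Submodule.sum_mem _ fun a _ => Submodule.smul_mem _ _ (LinearMap.mem_range_self A _)
  · rintro _ ⟨v, rfl⟩
    have h : inner ℝ w (A v) = inner ℝ w (A (∑ b, (inner ℝ (A v) (A (f b)) : ℝ) • f b)) := by
      rw [← starProjection_orthogonal_ker_eq_sum hA, map_starProjection_orthogonal_ker]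
    rw [inner_sub_left, h]
    simp only [map_sum, map_smul, inner_sum, sum_inner, real_inner_smul_left,
      real_inner_smul_right]
    rw [sub_eq_zero]
    refine Finset.sum_congr rfl fun a _ => ?_
    rw [real_inner_comm (A v), mul_comm]

lemma finrank_range_eq_sum (f : OrthonormalBasis ι ℝ V₁) :
    (finrank ℝ (LinearMap.range A) : ℝ) = ∑ a, inner ℝ (A (f a)) (A (f a)) := by
  set e := stdOrthonormalBasis ℝ (LinearMap.ker A)ᗮ
  have h1 : ∀ a, inner ℝ (A (f a)) (A (f a)) = ∑ i, inner ℝ (e i : V₁) (f a) ^ 2 := by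
    intro a
    rw [← inner_starProjection_orthogonal_ker hA, starProjection_eq_sum_orthonormalBasis e]
    simp only [sum_inner, real_inner_smul_left, sq]
  have h2 : ∀ i, ∑ a, inner ℝ (e i : V₁) (f a) ^ 2 = 1 := by
    intro i
    have h3 := f.sum_sq_norm_inner_left (e i : V₁)
    have h4 : ‖(e i : V₁)‖ = 1 := e.orthonormal.1 i
    simpa [h4] using h3
  simp only [h1]
  rw [Finset.sum_comm]
  simp [h2, finrank_range_eq_finrank_orthogonal_ker]

end LinearAlgebra

/-! ### Smoothness and antisymmetry of the connection forms -/

section Metric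

open Module Topology

variable {E : Type*} [NormedAddCommGroup E] [NormedSpace ℝ E] [FiniteDimensional ℝ E]
  {H : Type*} [TopologicalSpace H] {I : ModelWithCorners ℝ E H}
  {M : Type*} [TopologicalSpace M] [ChartedSpace H M] [IsManifold I ∞ M]
  [RiemannianBundle (fun x : M => TangentSpace I x)]
  [IsContMDiffRiemannianBundle I ∞ E (fun x : M => TangentSpace I x)]
  {X Y Z : ∀ x : M, TangentSpace I x} {x : M} {U : Set M}
  {s : Fin (finrank ℝ E) → ∀ y : M, TangentSpace I y}

lemma contMDiffOn_mlieBracket (hU : IsOpen U) (hX : CMDiff[U] ∞ (T% X))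
    (hY : CMDiff[U] ∞ (T% Y)) : CMDiff[U] ∞ (T% (mlieBracket I X Y)) := by
  have : CompleteSpace E := FiniteDimensional.complete ℝ E
  have : IsManifold I (minSmoothness ℝ 2) M := by
    rw [minSmoothness_of_isRCLikeNormedField]; infer_instance
  have : IsManifold I (((⊤ : ℕ∞) : ℕ∞ω) + 1) M := ‹IsManifold I ∞ M›
  intro x hx
  exact (ContMDiffAt.mlieBracket_vectorField (m := ⊤) (n := ⊤)
    ((hX x hx).contMDiffAt (hU.mem_nhds hx)) ((hY x hx).contMDiffAt (hU.mem_nhds hx))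
    (by simp)).contMDiffWithinAt

lemma contMDiffOn_inner_leviCivita (hU : IsOpen U) (hX : CMDiff[U] ∞ (T% X))
    (hY : CMDiff[U] ∞ (T% Y)) (hZ : CMDiff[U] ∞ (T% Z)) :
    CMDiff[U] ∞ (fun x => inner ℝ (leviCivita I Y x (X x)) (Z x)) := by
  have hk : CMDiff[U] ∞ (fun x => (1 / 2 : ℝ) * koszul I X Y Z x) := by
    unfold koszul
    refine contMDiffOn_const.mul (ContMDiffOn.sub (.sub (.add (.sub (.add ?_ ?_) ?_) ?_) ?_) ?_)
    · exact contMDiffOn_mvfderiv_apply hU (contMDiffOn_inner hY hZ) hX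
    · exact contMDiffOn_mvfderiv_apply hU (contMDiffOn_inner hZ hX) hY
    · exact contMDiffOn_mvfderiv_apply hU (contMDiffOn_inner hX hY) hZ
    · exact contMDiffOn_inner (contMDiffOn_mlieBracket hU hX hY) hZ
    · exact contMDiffOn_inner (contMDiffOn_mlieBracket hU hX hZ) hY
    · exact contMDiffOn_inner (contMDiffOn_mlieBracket hU hY hZ) hX
  refine hk.congr fun x hx => ?_
  have hd : ∀ {W : ∀ x : M, TangentSpace I x}, CMDiff[U] ∞ (T% W) → MDiffAt (T% W) x := fun hW =>
    ((hW x hx).contMDiffAt (hU.mem_nhds hx)).mdifferentiableAt (by simp)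
  exact inner_leviCivita I (hd hX) (hd hY) (hd hZ)

/-- The connection forms of an orthonormal frame are antisymmetric. -/
lemma IsOrthonormalFrameOn.inner_leviCivita_antisymm (hs : IsOrthonormalFrameOn I s U)
    (hx : x ∈ U) (c d : Fin (finrank ℝ E)) (u : TangentSpace I x) :
    (inner ℝ (leviCivita I (s c) x u) (s d x) : ℝ)
      = - inner ℝ (leviCivita I (s d) x u) (s c x) := by
  have hconst : (fun y => (inner ℝ (s c y) (s d y) : ℝ)) =ᶠ[𝓝 x]
      fun _ => inner ℝ (s c x) (s d x) := by
    filter_upwards [hs.isOpen.mem_nhds hx] with y hy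
    classical
    rw [orthonormal_iff_ite.1 (hs.orthonormal y hy), orthonormal_iff_ite.1 (hs.orthonormal x hx)]
  have h := leviCivita_metric I (mdifferentiableAt_extend I E u) (hs.mdifferentiableAt hx c)
    (hs.mdifferentiableAt hx d)
  rw [mvfderiv_congr hconst, mvfderiv_const, extend_apply_self, real_inner_comm] at h
  simp only [zero_apply] at h
  rw [real_inner_comm]
  linarith [real_inner_comm (leviCivita I (s d) x u) (s c x)]

end Metric

/-! ### Vector fields along a map -/

section Along

open Module Topology

variable {E₁ : Type*} [NormedAddCommGroup E₁] [NormedSpace ℝ E₁]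
  {B₁ : Type*} [TopologicalSpace B₁] {I₁ : ModelWithCorners ℝ E₁ B₁}
  {M₁ : Type*} [TopologicalSpace M₁] [ChartedSpace B₁ M₁]
  {E₂ : Type*} [NormedAddCommGroup E₂] [NormedSpace ℝ E₂] [FiniteDimensional ℝ E₂]
  {B₂ : Type*} [TopologicalSpace B₂] {I₂ : ModelWithCorners ℝ E₂ B₂}
  {M₂ : Type*} [TopologicalSpace M₂] [ChartedSpace B₂ M₂] [IsManifold I₂ ∞ M₂]
  [RiemannianBundle (fun x : M₂ => TangentSpace I₂ x)]
  [IsContMDiffRiemannianBundle I₂ ∞ E₂ (fun x : M₂ => TangentSpace I₂ x)]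
  {F : M₁ → M₂} {V V' : ∀ p : M₁, TangentSpace I₂ (F p)} {p : M₁}
  {s : Fin (finrank ℝ E₂) → ∀ y : M₂, TangentSpace I₂ y} {U : Set M₂} {O : Set M₁}

/-- The pullback connection is compatible with the metric. -/
lemma pullbackConnection_metric (hs : IsOrthonormalFrameOn I₂ s U) (hp : F p ∈ U)
    (hF : MDiffAt F p) (hV : ∀ c, MDiffAt (fun q => inner ℝ (V q) (s c (F q))) p)
    (hV' : ∀ c, MDiffAt (fun q => inner ℝ (V' q) (s c (F q))) p) (x : TangentSpace I₁ p) :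
    mvfderiv I₁ (fun q => inner ℝ (V q) (V' q)) p x
      = inner ℝ (pullbackConnection I₁ I₂ F V p x) (V' p)
        + inner ℝ (V p) (pullbackConnection I₁ I₂ F V' p x) := by
  have hev : (fun q => (inner ℝ (V q) (V' q) : ℝ)) =ᶠ[𝓝 p]
      fun q => ∑ c, inner ℝ (V q) (s c (F q)) * inner ℝ (V' q) (s c (F q)) := by
    filter_upwards [hF.continuousAt.preimage_mem_nhds (hs.isOpen.mem_nhds hp)] with q hq
    exact (hs.sum_inner_mul_inner hq _ _).symm
  have hm : ∀ c, mvfderiv I₁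
      (fun q => (inner ℝ (V q) (s c (F q)) * inner ℝ (V' q) (s c (F q)) : ℝ)) p x
      = mvfderiv I₁ (fun q => (inner ℝ (V q) (s c (F q)) : ℝ)) p x * inner ℝ (V' p) (s c (F p))
        + mvfderiv I₁ (fun q => (inner ℝ (V' q) (s c (F q)) : ℝ)) p x
          * inner ℝ (V p) (s c (F p)) := by
    intro c
    rw [mvfderiv_fun_mul (hV c) (hV' c)]
    simp only [add_apply, smul_apply, smul_eq_mul]
    ring
  have hsum := mvfderiv_finsetSum (I := I₁) (t := Finset.univ) (x := p)
    (g := fun c q => (inner ℝ (V q) (s c (F q)) * inner ℝ (V' q) (s c (F q)) : ℝ))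
    fun c _ => (hV c).mul (hV' c)
  rw [mvfderiv_congr hev, hsum, sum_apply, Finset.sum_congr rfl fun c _ => hm c,
    pullbackConnection_eq_sum hs hp hF hV, pullbackConnection_eq_sum hs hp hF hV']
  set L := fun c => leviCivita I₂ (s c) (F p) (mfderiv I₁ I₂ F p x) with hL
  -- The connection terms cancel, by antisymmetry of `⟪∇ s_c, s_d⟫` in `c` and `d`.
  have hanti : ∑ c, inner ℝ (V p) (s c (F p)) * inner ℝ (L c) (V' p)
      + ∑ c, inner ℝ (V' p) (s c (F p)) * inner ℝ (V p) (L c) = (0 : ℝ) := by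
    have h1 : ∀ (W : TangentSpace I₂ (F p)) (c : Fin (finrank ℝ E₂)), (inner ℝ (L c) W : ℝ)
        = ∑ d, inner ℝ W (s d (F p)) * inner ℝ (L c) (s d (F p)) := fun W c => by
      rw [← hs.sum_inner_mul_inner hp (L c) W]
      exact Finset.sum_congr rfl fun _ _ => mul_comm _ _
    have h2 : ∀ c, (inner ℝ (V p) (L c) : ℝ) = inner ℝ (L c) (V p) := fun c => real_inner_comm _ _
    simp only [h2]
    simp only [h1 (V p), h1 (V' p), Finset.mul_sum]
    conv_lhs => arg 2; rw [Finset.sum_comm]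
    rw [← Finset.sum_add_distrib]
    refine Finset.sum_eq_zero fun c _ => ?_
    rw [← Finset.sum_add_distrib]
    refine Finset.sum_eq_zero fun d _ => ?_
    rw [hs.inner_leviCivita_antisymm hp c d]
    ring
  have hc : ∀ c, (inner ℝ (s c (F p)) (V' p) : ℝ) = inner ℝ (V' p) (s c (F p)) := fun c =>
    real_inner_comm _ _
  simp only [sum_inner, inner_sum, inner_add_left, inner_add_right, real_inner_smul_left,
    real_inner_smul_right, Finset.sum_add_distrib, hc]
  linarith

/-- Leibniz rule for the pullback connection, for the products of a function and a vector field
along `F`, summed over a finite family. -/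
lemma pullbackConnection_sum_smul (hs : IsOrthonormalFrameOn I₂ s U) (hp : F p ∈ U)
    (hF : MDiffAt F p) {ι : Type*} [Fintype ι] {y : ι → M₁ → ℝ}
    {W : ι → ∀ p : M₁, TangentSpace I₂ (F p)} (hy : ∀ a, MDiffAt (y a) p)
    (hW : ∀ a c, MDiffAt (fun q => inner ℝ (W a q) (s c (F q))) p) (x : TangentSpace I₁ p) :
    pullbackConnection I₁ I₂ F (fun q => ∑ a, y a q • W a q) p x
      = ∑ a, (mvfderiv I₁ (y a) p x • W a p + y a p • pullbackConnection I₁ I₂ F (W a) p x) := by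
  have hin : ∀ c, (fun q => (inner ℝ (∑ a, y a q • W a q) (s c (F q)) : ℝ))
      = fun q => ∑ a, y a q * inner ℝ (W a q) (s c (F q)) := fun c => by
    funext q
    simp only [sum_inner, real_inner_smul_left]
  have hd : ∀ c, MDiffAt (fun q => (inner ℝ (∑ a, y a q • W a q) (s c (F q)) : ℝ)) p := fun c => by
    rw [hin c]
    exact mdifferentiableAt_finsetSum fun a _ => (hy a).mul (hW a c)
  have hm : ∀ c, mvfderiv I₁ (fun q => (inner ℝ (∑ a, y a q • W a q) (s c (F q)) : ℝ)) p x
      = ∑ a, (mvfderiv I₁ (y a) p x * inner ℝ (W a p) (s c (F p))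
        + y a p * mvfderiv I₁ (fun q => (inner ℝ (W a q) (s c (F q)) : ℝ)) p x) := fun c => by
    have h := mvfderiv_finsetSum (I := I₁) (t := Finset.univ) (x := p)
      (g := fun a q => (y a q * inner ℝ (W a q) (s c (F q)) : ℝ))
      fun a _ => (hy a).mul (hW a c)
    rw [hin c, h, sum_apply]
    refine Finset.sum_congr rfl fun a _ => ?_
    rw [mvfderiv_fun_mul (hy a) (hW a c)]
    simp only [add_apply, smul_apply, smul_eq_mul]
    ring
  rw [pullbackConnection_eq_sum hs hp hF hd]
  simp only [hm]
  simp only [sum_inner, real_inner_smul_left, Finset.sum_smul, ← Finset.sum_add_distrib]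
  rw [Finset.sum_comm]
  refine Finset.sum_congr rfl fun a _ => ?_
  rw [pullbackConnection_eq_sum hs hp hF (hW a)]
  conv_rhs => arg 1; rw [← hs.sum_inner_smul hp (W a p)]
  rw [Finset.smul_sum, Finset.smul_sum, ← Finset.sum_add_distrib]
  refine Finset.sum_congr rfl fun c _ => ?_
  module

variable (I₁ I₂) in
/-- The vector field `V` along `F` has smooth components over `O` in the frame `(s_c)`. -/
def SmoothAlong (F : M₁ → M₂) (s : Fin (finrank ℝ E₂) → ∀ y : M₂, TangentSpace I₂ y) (O : Set M₁)
    (V : ∀ p : M₁, TangentSpace I₂ (F p)) : Prop :=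
  ∀ c, CMDiff[O] ∞ (fun q => (inner ℝ (V q) (s c (F q)) : ℝ))

namespace SmoothAlong

lemma mdifferentiableAt (hV : SmoothAlong I₁ I₂ F s O V) (hO : IsOpen O) (hp : p ∈ O)
    (c : Fin (finrank ℝ E₂)) : MDiffAt (fun q => (inner ℝ (V q) (s c (F q)) : ℝ)) p :=
  ((hV c p hp).contMDiffAt (hO.mem_nhds hp)).mdifferentiableAt (by simp)

lemma sub (hV : SmoothAlong I₁ I₂ F s O V) (hV' : SmoothAlong I₁ I₂ F s O V') :
    SmoothAlong I₁ I₂ F s O (fun q => V q - V' q) := fun c => by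
  simp only [inner_sub_left]
  exact (hV c).sub (hV' c)

lemma smul {y : M₁ → ℝ} (hy : CMDiff[O] ∞ y) (hV : SmoothAlong I₁ I₂ F s O V) :
    SmoothAlong I₁ I₂ F s O (fun q => y q • V q) := fun c => by
  simp only [real_inner_smul_left]
  exact hy.mul (hV c)

lemma sum {ι : Type*} {t : Finset ι} {W : ι → ∀ p : M₁, TangentSpace I₂ (F p)}
    (hW : ∀ a ∈ t, SmoothAlong I₁ I₂ F s O (W a)) :
    SmoothAlong I₁ I₂ F s O (fun q => ∑ a ∈ t, W a q) := fun c => by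
  simp only [sum_inner]
  exact contMDiffOn_finsetSum fun a ha => hW a ha c

lemma contMDiffOn_inner (hs : IsOrthonormalFrameOn I₂ s U) (hO : Set.MapsTo F O U)
    (hV : SmoothAlong I₁ I₂ F s O V) (hV' : SmoothAlong I₁ I₂ F s O V') :
    CMDiff[O] ∞ (fun q => (inner ℝ (V q) (V' q) : ℝ)) := by
  have h : CMDiff[O] ∞ (fun q =>
      ∑ c, (inner ℝ (V q) (s c (F q)) * inner ℝ (V' q) (s c (F q)) : ℝ)) :=
    contMDiffOn_finsetSum fun c _ => (hV c).mul (hV' c)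
  exact h.congr fun q hq => (hs.sum_inner_mul_inner (hO hq) _ _).symm

variable [IsManifold I₁ ∞ M₁] {X : ∀ p : M₁, TangentSpace I₁ p}

lemma pushforward (hs : IsOrthonormalFrameOn I₂ s U) (hOo : IsOpen O) (hO : Set.MapsTo F O U)
    (hF : CMDiff[O] ∞ F) (hX : CMDiff[O] ∞ (T% X)) :
    SmoothAlong I₁ I₂ F s O (push I₁ I₂ F X) := fun c => by
  have h1 := (hF.contMDiffOn_tangentMapWithin (m := ∞) (by simp) hOo.uniqueMDiffOn).comp hX
    (fun x hx => hx)
  have h2 : ContMDiffOn I₁ I₂.tangent ∞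
      (fun q => (⟨F q, push I₁ I₂ F X q⟩ : TangentBundle I₂ M₂)) O := by
    refine h1.congr fun q hq => ?_
    simp only [Function.comp, tangentMapWithin, push]
    rw [mfderivWithin_of_isOpen hOo hq]
  exact ContMDiffOn.inner_bundle (E := fun x : M₂ => TangentSpace I₂ x) (F := E₂) (IB := I₂)
    (b := F) h2 ((hs.contMDiffOn c).comp hF hO)

lemma covariantDerivative (hs : IsOrthonormalFrameOn I₂ s U) (hOo : IsOpen O)
    (hO : Set.MapsTo F O U) (hF : CMDiff[O] ∞ F) (hX : CMDiff[O] ∞ (T% X))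
    (hV : SmoothAlong I₁ I₂ F s O V) :
    SmoothAlong I₁ I₂ F s O (fun q => pullbackConnection I₁ I₂ F V q (X q)) := fun c => by
  have hpush := pushforward hs hOo hO hF hX
  have h : CMDiff[O] ∞ (fun q => mvfderiv I₁ (fun q => (inner ℝ (V q) (s c (F q)) : ℝ)) q (X q)
      + ∑ d, inner ℝ (V q) (s d (F q))
        * ∑ e, inner ℝ (push I₁ I₂ F X q) (s e (F q))
          * inner ℝ (leviCivita I₂ (s d) (F q) (s e (F q))) (s c (F q))) := by
    refine (contMDiffOn_mvfderiv_apply hOo (hV c) hX).add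
      (contMDiffOn_finsetSum fun d _ => (hV d).mul (contMDiffOn_finsetSum fun e _ =>
        (hpush e).mul ?_))
    exact (contMDiffOn_inner_leviCivita hs.isOpen (hs.contMDiffOn e) (hs.contMDiffOn d)
      (hs.contMDiffOn c)).comp hF hO
  refine h.congr fun q hq => ?_
  have hd : MDiffAt F q := (hF.contMDiffAt (hOo.mem_nhds hq)).mdifferentiableAt (by simp)
  dsimp only
  rw [pullbackConnection_eq_sum hs (hO hq) hd (hV.mdifferentiableAt hOo hq)]
  simp only [sum_inner, inner_add_left, real_inner_smul_left, Finset.sum_add_distrib]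
  congr 1
  · classical
    simp [orthonormal_iff_ite.1 (hs.orthonormal _ (hO hq))]
  · refine Finset.sum_congr rfl fun d _ => ?_
    congr 1
    change inner ℝ (leviCivita I₂ (s d) (F q) (push I₁ I₂ F X q)) _ = _
    conv_lhs => rw [← hs.sum_inner_smul (hO hq) (push I₁ I₂ F X q)]
    simp only [map_sum, map_smul, sum_inner, real_inner_smul_left]

end SmoothAlong

end Along

/-! ### Riemannian maps -/

section RiemannianMap

open Module Topology

variable {E₁ : Type*} [NormedAddCommGroup E₁] [NormedSpace ℝ E₁] [FiniteDimensional ℝ E₁]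
  {B₁ : Type*} [TopologicalSpace B₁] {I₁ : ModelWithCorners ℝ E₁ B₁}
  {M₁ : Type*} [TopologicalSpace M₁] [ChartedSpace B₁ M₁] [IsManifold I₁ ∞ M₁]
  [RiemannianBundle (fun x : M₁ => TangentSpace I₁ x)]
  [IsContMDiffRiemannianBundle I₁ ∞ E₁ (fun x : M₁ => TangentSpace I₁ x)]
  {E₂ : Type*} [NormedAddCommGroup E₂] [NormedSpace ℝ E₂] [FiniteDimensional ℝ E₂]
  {B₂ : Type*} [TopologicalSpace B₂] {I₂ : ModelWithCorners ℝ E₂ B₂}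
  {M₂ : Type*} [TopologicalSpace M₂] [ChartedSpace B₂ M₂] [IsManifold I₂ ∞ M₂]
  [RiemannianBundle (fun x : M₂ => TangentSpace I₂ x)]
  [IsContMDiffRiemannianBundle I₂ ∞ E₂ (fun x : M₂ => TangentSpace I₂ x)]
  {F : M₁ → M₂} {p : M₁}

lemma push_mem_rangeSpace (X : ∀ p : M₁, TangentSpace I₁ p) (p : M₁) :
    push I₁ I₂ F X p ∈ rangeSpace I₁ I₂ F p :=
  LinearMap.mem_range_self _ _

lemma meanCurvature_mem_orthogonal (F : M₁ → M₂) (p : M₁) :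
    meanCurvature I₁ I₂ F p ∈ (rangeSpace I₁ I₂ F p)ᗮ :=
  Submodule.smul_mem _ _ (Submodule.sum_mem _ fun _ _ => Submodule.starProjection_apply_mem _ _)

lemma inner_meanCurvature_of_mem {w : TangentSpace I₂ (F p)} (hw : w ∈ rangeSpace I₁ I₂ F p) :
    (inner ℝ w (meanCurvature I₁ I₂ F p) : ℝ) = 0 :=
  (meanCurvature_mem_orthogonal F p) w hw

/-- Around each point, there are orthonormal frames of `TM₁` and `TM₂` over neighbourhoods `O` and
`U` with `F(O) ⊆ U`. -/
lemma exists_frames (hF : Continuous F) (p : M₁) :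
    ∃ (O : Set M₁) (U : Set M₂) (f : Fin (finrank ℝ E₁) → ∀ x : M₁, TangentSpace I₁ x)
      (s : Fin (finrank ℝ E₂) → ∀ x : M₂, TangentSpace I₂ x),
      p ∈ O ∧ Set.MapsTo F O U ∧ IsOrthonormalFrameOn I₁ f O ∧ IsOrthonormalFrameOn I₂ s U := by
  obtain ⟨O, f, hpO, hf⟩ := exists_isOrthonormalFrameOn (I := I₁) p
  obtain ⟨U, s, hpU, hs⟩ := exists_isOrthonormalFrameOn (I := I₂) (F p)
  exact ⟨O ∩ F ⁻¹' U, U, f, s, ⟨hpO, hpU⟩, fun q hq => hq.2,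
    hf.mono (hf.isOpen.inter (hs.isOpen.preimage hF)) Set.inter_subset_left, hs⟩

variable {O : Set M₁} {U : Set M₂} {f : Fin (finrank ℝ E₁) → ∀ x : M₁, TangentSpace I₁ x}
  {s : Fin (finrank ℝ E₂) → ∀ x : M₂, TangentSpace I₂ x}

/-- The form `(∇_x F_* Y)ᗮ` is tensorial in `Y`. -/
lemma starProjection_pullbackConnection_push (hF : ContMDiff I₁ I₂ ∞ F)
    (hf : IsOrthonormalFrameOn I₁ f O) (hs : IsOrthonormalFrameOn I₂ s U)
    (hO : Set.MapsTo F O U) (hp : p ∈ O) {Y : ∀ p : M₁, TangentSpace I₁ p}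
    (hY : MDiffAt (T% Y) p) (x : TangentSpace I₁ p) :
    (rangeSpace I₁ I₂ F p)ᗮ.starProjection
        (pullbackConnection I₁ I₂ F (push I₁ I₂ F Y) p x)
      = ∑ a, (inner ℝ (Y p) (f a p) : ℝ) • (rangeSpace I₁ I₂ F p)ᗮ.starProjection
          (pullbackConnection I₁ I₂ F (push I₁ I₂ F (f a)) p x) := by
  have hev : ∀ᶠ q in 𝓝 p, push I₁ I₂ F Y q
      = ∑ a, (inner ℝ (Y q) (f a q) : ℝ) • push I₁ I₂ F (f a) q := by
    filter_upwards [hf.isOpen.mem_nhds hp] with q hq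
    rw [push]
    conv_lhs => rw [← hf.sum_inner_smul hq (Y q)]
    simp only [map_sum, map_smul, push]
  have hpush : ∀ a, SmoothAlong I₁ I₂ F s O (push I₁ I₂ F (f a)) := fun a =>
    SmoothAlong.pushforward hs hf.isOpen hO hF.contMDiffOn (hf.contMDiffOn a)
  rw [pullbackConnection_congr hev, pullbackConnection_sum_smul hs (hO hp)
    (hF.mdifferentiableAt (by simp)) (fun a => mdiffAt_inner I₁ hY (hf.mdifferentiableAt hp a))
    (fun a c => (hpush a).mdifferentiableAt hf.isOpen hp c), map_sum]
  refine Finset.sum_congr rfl fun a _ => ?_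
  have h0 : (rangeSpace I₁ I₂ F p)ᗮ.starProjection (push I₁ I₂ F (f a) p) = 0 := by
    rw [Submodule.starProjection_apply_eq_zero_iff, Submodule.orthogonal_orthogonal]
    exact push_mem_rangeSpace _ _
  rw [map_add, map_smul, map_smul, h0, smul_zero, zero_add]

variable (I₁ I₂) in
/-- The sum `∑_a ∇_{P f_a} F_* f_a` for a frame `(f_a)` of `TM₁`, where `P` is the projection onto
`(ker F_*)ᗮ`, written out as `P f_a = ∑_b ⟪F_* f_a, F_* f_b⟫ f_b`. Its component orthogonal to
`range F_*` is `m₂ H₂` if the frame is orthonormal and `F` is a Riemannian map. -/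
def frameTrace (F : M₁ → M₂) (f : Fin (finrank ℝ E₁) → ∀ x : M₁, TangentSpace I₁ x) (q : M₁) :
    TangentSpace I₂ (F q) :=
  ∑ a, ∑ b, (inner ℝ (push I₁ I₂ F (f a) q) (push I₁ I₂ F (f b) q) : ℝ) •
    pullbackConnection I₁ I₂ F (push I₁ I₂ F (f a)) q (f b q)

/-- The mean curvature in a local orthonormal frame of `TM₁`. All terms depend smoothly on `p`:
the rank of `F` is `∑ |F_* f_a|²`, and the projection onto `range F_*` is
`w ↦ ∑ ⟪w, F_* f_a⟫ F_* f_a`. -/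
lemma meanCurvature_eq_frame (hF : IsRiemannianMap I₁ I₂ F)
    (hf : IsOrthonormalFrameOn I₁ f O) (hs : IsOrthonormalFrameOn I₂ s U)
    (hO : Set.MapsTo F O U) (hp : p ∈ O) :
    meanCurvature I₁ I₂ F p
      = (∑ a, (inner ℝ (push I₁ I₂ F (f a) p) (push I₁ I₂ F (f a) p) : ℝ))⁻¹ •
        (frameTrace I₁ I₂ F f p - ∑ a, (inner ℝ (frameTrace I₁ I₂ F f p)
          (push I₁ I₂ F (f a) p) : ℝ) • push I₁ I₂ F (f a) p) := by
  obtain ⟨b, hb⟩ := hf.exists_basis hp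
  set A := (mfderiv I₁ I₂ F p).toLinearMap with hA
  have hiso : ∀ x ∈ (LinearMap.ker A)ᗮ, ∀ y ∈ (LinearMap.ker A)ᗮ,
    inner ℝ (A x) (A y) = inner ℝ x y := hF.inner_eq p
  have hAf : ∀ a, push I₁ I₂ F (f a) p = A (b a) := fun a => by rw [hb]; rfl
  have hrank : (finrank ℝ (rangeSpace I₁ I₂ F p) : ℝ)
      = ∑ a, inner ℝ (push I₁ I₂ F (f a) p) (push I₁ I₂ F (f a) p) := by
    simp only [hAf]
    exact finrank_range_eq_sum hiso b
  have hproj : ∀ w, w - ∑ a, (inner ℝ w (push I₁ I₂ F (f a) p) : ℝ) • push I₁ I₂ F (f a) p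
      = (rangeSpace I₁ I₂ F p)ᗮ.starProjection w := fun w => by
    simp only [hAf]
    rw [Submodule.starProjection_orthogonal_val]
    exact congrArg _ (starProjection_range_eq_sum hiso b w).symm
  rw [meanCurvature, hrank, hproj]
  congr 1
  set e := stdOrthonormalBasis ℝ (horizontalSpace I₁ I₂ F p) with he
  have hext : ∀ i, (rangeSpace I₁ I₂ F p)ᗮ.starProjection (pullbackConnection I₁ I₂ F
        (push I₁ I₂ F (extend E₁ (e i : TangentSpace I₁ p))) p (e i : TangentSpace I₁ p))
      = ∑ a, (rangeSpace I₁ I₂ F p)ᗮ.starProjection (pullbackConnection I₁ I₂ F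
        (push I₁ I₂ F (f a)) p ((inner ℝ (e i : TangentSpace I₁ p) (f a p) : ℝ) •
          (e i : TangentSpace I₁ p))) := fun i => by
    rw [starProjection_pullbackConnection_push hF.contMDiff hf hs hO hp
      (mdifferentiableAt_extend I₁ E₁ _), extend_apply_self]
    simp only [map_smul]
  simp only [hext]
  rw [Finset.sum_comm, frameTrace, map_sum]
  refine Finset.sum_congr rfl fun a _ => ?_
  have hP : ∑ i, (inner ℝ (e i : TangentSpace I₁ p) (f a p) : ℝ) • (e i : TangentSpace I₁ p)
      = ∑ c, (inner ℝ (push I₁ I₂ F (f a) p) (push I₁ I₂ F (f c) p) : ℝ) • f c p := by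
    rw [← starProjection_eq_sum_orthonormalBasis e]
    simp only [hAf]
    rw [← hb]
    refine (starProjection_orthogonal_ker_eq_sum hiso b (b a)).trans ?_
    simp only [hb]
  rw [← map_sum, ← map_sum, hP]
  simp only [map_sum, map_smul]

lemma smoothAlong_meanCurvature (hF : IsRiemannianMap I₁ I₂ F)
    (hrank : ∀ p : M₁, 0 < finrank ℝ (rangeSpace I₁ I₂ F p))
    (hf : IsOrthonormalFrameOn I₁ f O) (hs : IsOrthonormalFrameOn I₂ s U)
    (hO : Set.MapsTo F O U) : SmoothAlong I₁ I₂ F s O (meanCurvature I₁ I₂ F) := by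
  have hpush : ∀ a, SmoothAlong I₁ I₂ F s O (push I₁ I₂ F (f a)) := fun a =>
    SmoothAlong.pushforward hs hf.isOpen hO hF.contMDiff.contMDiffOn (hf.contMDiffOn a)
  have htr : SmoothAlong I₁ I₂ F s O (frameTrace I₁ I₂ F f) :=
    .sum fun a _ => .sum fun c _ => .smul ((hpush a).contMDiffOn_inner hs hO (hpush c))
      ((hpush a).covariantDerivative hs hf.isOpen hO hF.contMDiff.contMDiffOn (hf.contMDiffOn c))
  have hm : ∀ q ∈ O, (∑ a, inner ℝ (push I₁ I₂ F (f a) q) (push I₁ I₂ F (f a) q) : ℝ) ≠ 0 := by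
    intro q hq
    obtain ⟨b, hb⟩ := hf.exists_basis hq
    have h := finrank_range_eq_sum (A := (mfderiv I₁ I₂ F q).toLinearMap) (hF.inner_eq q) b
    simp only [hb] at h
    exact fun h0 => (hrank q).ne' (Nat.cast_eq_zero.1 (h.trans h0))
  have hH := (htr.sub (.sum (t := Finset.univ) fun a _ =>
    (hpush a).smul (htr.contMDiffOn_inner hs hO (hpush a)))).smul
      ((contMDiffOn_finsetSum fun a (_ : a ∈ Finset.univ) =>
        (hpush a).contMDiffOn_inner hs hO (hpush a)).inv₀ hm)
  intro c
  refine (hH c).congr fun q hq => ?_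
  rw [meanCurvature_eq_frame hF hf hs hO hq]

/-- The Weingarten relation `⟪A_{H₂} F_* X, F_* Y⟫ = ⟪(∇F_*)(X, Y), H₂⟫`, obtained by
differentiating `⟪H₂, F_* Y⟫ = 0`. -/
lemma inner_shapeOperator_meanCurvature (hF : IsRiemannianMap I₁ I₂ F)
    (hrank : ∀ p : M₁, 0 < finrank ℝ (rangeSpace I₁ I₂ F p)) {X Y : ∀ p : M₁, TangentSpace I₁ p}
    (hY : ContMDiff I₁ I₁.tangent ∞ (fun p => (⟨p, Y p⟩ : TangentBundle I₁ M₁))) (p : M₁) :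
    (inner ℝ (shapeOperator I₁ I₂ F (meanCurvature I₁ I₂ F) X p) (push I₁ I₂ F Y p) : ℝ)
      = inner ℝ (secondFundamentalForm I₁ I₂ F X Y p) (meanCurvature I₁ I₂ F p) := by
  obtain ⟨O, U, f, s, hp, hO, hf, hs⟩ := exists_frames (I₁ := I₁) (I₂ := I₂)
    hF.contMDiff.continuous p
  have hH := smoothAlong_meanCurvature hF hrank hf hs hO
  have hYs : SmoothAlong I₁ I₂ F s O (push I₁ I₂ F Y) :=
    SmoothAlong.pushforward hs hf.isOpen hO hF.contMDiff.contMDiffOn hY.contMDiffOn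
  have hmet := pullbackConnection_metric hs (hO hp) (hF.contMDiff.mdifferentiableAt (by simp))
    (hH.mdifferentiableAt hf.isOpen hp) (hYs.mdifferentiableAt hf.isOpen hp) (X p)
  have h0 : (fun q => (inner ℝ (meanCurvature I₁ I₂ F q) (push I₁ I₂ F Y q) : ℝ)) = fun _ => 0 := by
    funext q
    rw [real_inner_comm]
    exact inner_meanCurvature_of_mem (push_mem_rangeSpace _ _)
  rw [h0, mvfderiv_const, zero_apply] at hmet
  have htan : (inner ℝ (mfderiv I₁ I₂ F p (leviCivita I₁ Y p (X p)))
      (meanCurvature I₁ I₂ F p) : ℝ) = 0 :=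
    inner_meanCurvature_of_mem (LinearMap.mem_range_self _ _)
  rw [shapeOperator, inner_neg_left, Submodule.inner_starProjection_left_eq_right,
    Submodule.starProjection_eq_self_iff.2 (push_mem_rangeSpace Y p), secondFundamentalForm,
    inner_sub_left, htan, sub_zero]
  linarith [real_inner_comm (meanCurvature I₁ I₂ F p)
    (pullbackConnection I₁ I₂ F (push I₁ I₂ F Y) p (X p))]

variable (I₁ I₂ F) in
/-- The pointwise orthogonal projection of the vector field `X` onto the distribution
`(ker F_*)ᗮ`. -/
def horizontalPart (X : ∀ p : M₁, TangentSpace I₁ p) (p : M₁) : TangentSpace I₁ p :=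
  (horizontalSpace I₁ I₂ F p).starProjection (X p)

lemma push_horizontalPart (X : ∀ p : M₁, TangentSpace I₁ p) :
    push I₁ I₂ F (horizontalPart I₁ I₂ F X) = push I₁ I₂ F X := by
  funext p
  exact map_starProjection_orthogonal_ker (mfderiv I₁ I₂ F p).toLinearMap (X p)

lemma isHorizontalField_horizontalPart (hF : IsRiemannianMap I₁ I₂ F)
    {X : ∀ p : M₁, TangentSpace I₁ p}
    (hX : ContMDiff I₁ I₁.tangent ∞ (fun p => (⟨p, X p⟩ : TangentBundle I₁ M₁))) :
    IsHorizontalField I₁ I₂ F (horizontalPart I₁ I₂ F X) where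
  mem p := Submodule.starProjection_apply_mem _ _
  contMDiff p := by
    obtain ⟨O, U, f, s, hp, hO, hf, hs⟩ := exists_frames (I₁ := I₁) (I₂ := I₂)
      hF.contMDiff.continuous p
    have hpush : ∀ a, SmoothAlong I₁ I₂ F s O (push I₁ I₂ F (f a)) := fun a =>
      SmoothAlong.pushforward hs hf.isOpen hO hF.contMDiff.contMDiffOn (hf.contMDiffOn a)
    have hXs : SmoothAlong I₁ I₂ F s O (push I₁ I₂ F X) :=
      SmoothAlong.pushforward hs hf.isOpen hO hF.contMDiff.contMDiffOn hX.contMDiffOn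
    have h : CMDiff[O] ∞ (T% (fun q => ∑ a,
        (inner ℝ (push I₁ I₂ F X q) (push I₁ I₂ F (f a) q) : ℝ) • f a q)) :=
      .sum_section fun a _ => (hXs.contMDiffOn_inner hs hO (hpush a)).smul_section
        (hf.contMDiffOn a)
    refine (h.congr fun q hq => ?_).contMDiffAt (hf.isOpen.mem_nhds hp)
    obtain ⟨b, hb⟩ := hf.exists_basis hq
    congr 1
    refine (starProjection_orthogonal_ker_eq_sum (A := (mfderiv I₁ I₂ F q).toLinearMap)
      (hF.inner_eq q) b (X q)).trans ?_
    simp only [hb]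
    rfl

/-- Every horizontal vector `u` at `p` is the value of a global smooth horizontal vector field `X`.
Since `F_*` annihilates vertical parts, `F_* X` can be chosen to agree near `p` with the image of
the extension of `u` that occurs in the definition of `meanCurvature`. -/
lemma exists_isHorizontalField [T2Space M₁] (hF : IsRiemannianMap I₁ I₂ F)
    {u : TangentSpace I₁ p} (hu : u ∈ horizontalSpace I₁ I₂ F p) :
    ∃ X : ∀ p : M₁, TangentSpace I₁ p, IsHorizontalField I₁ I₂ F X ∧ X p = u ∧
      ∀ᶠ q in 𝓝 p, push I₁ I₂ F X q = push I₁ I₂ F (extend E₁ u) q := by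
  obtain ⟨t, ht, hct⟩ := exists_contMDiffOn_extend (k := ∞) I₁ E₁ u
  obtain ⟨O, hOt, hOo, hpO⟩ := mem_nhds_iff.1 ht
  obtain ⟨χ, -, hχ⟩ := (SmoothBumpFunction.nhds_basis_tsupport (I := I₁) p).mem_iff.1
    (hOo.mem_nhds hpO)
  have hX := ContMDiffOn.smul_section_of_tsupport χ.contMDiff.contMDiffOn hOo hχ
    (hct.mono hOt)
  refine ⟨_, isHorizontalField_horizontalPart hF hX, ?_, ?_⟩
  · rw [horizontalPart, Pi.smul_apply', extend_apply_self, χ.eq_one, one_smul]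
    exact Submodule.starProjection_eq_self_iff.2 hu
  · rw [push_horizontalPart]
    filter_upwards [χ.eventuallyEq_one] with q hq
    rw [push, push, Pi.smul_apply', hq, Pi.one_apply, one_smul]

/-- If the second fundamental form in the direction of `H₂` is `c` times the metric on horizontal
vectors at `p`, then `c = ‖H₂(p)‖²`: take the trace over an orthonormal basis of `(ker F_{*p})ᗮ`. -/
lemma eq_norm_sq_of_inner_secondFundamentalForm [T2Space M₁] (hF : IsRiemannianMap I₁ I₂ F)
    (hrank : 0 < finrank ℝ (rangeSpace I₁ I₂ F p)) {c : ℝ}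
    (h : ∀ X Y : (∀ p : M₁, TangentSpace I₁ p),
      IsHorizontalField I₁ I₂ F X → IsHorizontalField I₁ I₂ F Y →
      inner ℝ (secondFundamentalForm I₁ I₂ F X Y p) (meanCurvature I₁ I₂ F p)
        = c * inner ℝ (X p) (Y p)) :
    c = ‖meanCurvature I₁ I₂ F p‖ ^ 2 := by
  set e := stdOrthonormalBasis ℝ (horizontalSpace I₁ I₂ F p) with he
  set m : ℝ := (finrank ℝ (rangeSpace I₁ I₂ F p) : ℝ) with hm
  have hm0 : m ≠ 0 := Nat.cast_ne_zero.2 hrank.ne'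
  set w := fun i => pullbackConnection I₁ I₂ F
    (push I₁ I₂ F (extend E₁ (e i : TangentSpace I₁ p))) p (e i : TangentSpace I₁ p) with hw
  have hi : ∀ i, (inner ℝ (w i) (meanCurvature I₁ I₂ F p) : ℝ) = c := by
    intro i
    obtain ⟨X, hX, hXp, hev⟩ := exists_isHorizontalField hF (e i).2
    have htan : (inner ℝ (mfderiv I₁ I₂ F p (leviCivita I₁ X p (X p)))
        (meanCurvature I₁ I₂ F p) : ℝ) = 0 :=
      inner_meanCurvature_of_mem (LinearMap.mem_range_self _ _)
    have h1 := h X X hX hX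
    have hn : ‖(e i : TangentSpace I₁ p)‖ = 1 := e.orthonormal.1 i
    rw [secondFundamentalForm, inner_sub_left, htan, sub_zero, pullbackConnection_congr hev, hXp,
      real_inner_self_eq_norm_sq, hn, one_pow, mul_one] at h1
    exact h1
  have hsum : ∑ i, (rangeSpace I₁ I₂ F p)ᗮ.starProjection (w i)
      = m • meanCurvature I₁ I₂ F p := by
    rw [meanCurvature, smul_inv_smul₀ hm0]
  have hproj : ∀ i, (inner ℝ (w i) (meanCurvature I₁ I₂ F p) : ℝ)
      = inner ℝ ((rangeSpace I₁ I₂ F p)ᗮ.starProjection (w i)) (meanCurvature I₁ I₂ F p) := by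
    intro i
    rw [Submodule.inner_starProjection_left_eq_right,
      Submodule.starProjection_eq_self_iff.2 (meanCurvature_mem_orthogonal F p)]
  have hdim : m = finrank ℝ (horizontalSpace I₁ I₂ F p) :=
    congrArg (Nat.cast : ℕ → ℝ)
      (finrank_range_eq_finrank_orthogonal_ker (mfderiv I₁ I₂ F p).toLinearMap)
  have key : m * c = m * ‖meanCurvature I₁ I₂ F p‖ ^ 2 := by
    calc m * c = ∑ i, (inner ℝ (w i) (meanCurvature I₁ I₂ F p) : ℝ) := by simp [hi, hdim]
      _ = m * ‖meanCurvature I₁ I₂ F p‖ ^ 2 := by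
        rw [Finset.sum_congr rfl fun i _ => hproj i, ← sum_inner, hsum, real_inner_smul_left,
          real_inner_self_eq_norm_sq]
  exact mul_left_cancel₀ hm0 key

end RiemannianMap

end RiemMap
end

theorem proposition3p1
    {E₁ : Type*} [NormedAddCommGroup E₁] [NormedSpace ℝ E₁] [FiniteDimensional ℝ E₁]
    {B₁ : Type*} [TopologicalSpace B₁] (I₁ : ModelWithCorners ℝ E₁ B₁) [I₁.Boundaryless]
    {M₁ : Type*} [TopologicalSpace M₁] [T2Space M₁] [ChartedSpace B₁ M₁] [IsManifold I₁ ∞ M₁]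
    [RiemannianBundle (fun x : M₁ => TangentSpace I₁ x)]
    [IsContMDiffRiemannianBundle I₁ ∞ E₁ (fun x : M₁ => TangentSpace I₁ x)]
    {E₂ : Type*} [NormedAddCommGroup E₂] [NormedSpace ℝ E₂] [FiniteDimensional ℝ E₂]
    {B₂ : Type*} [TopologicalSpace B₂] (I₂ : ModelWithCorners ℝ E₂ B₂) [I₂.Boundaryless]
    {M₂ : Type*} [TopologicalSpace M₂] [T2Space M₂] [ChartedSpace B₂ M₂] [IsManifold I₂ ∞ M₂]
    [RiemannianBundle (fun x : M₂ => TangentSpace I₂ x)]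
    [IsContMDiffRiemannianBundle I₂ ∞ E₂ (fun x : M₂ => TangentSpace I₂ x)]
    (F : M₁ → M₂) (hF : RiemMap.IsRiemannianMap I₁ I₂ F)
    (hrank : ∀ p : M₁, 0 < Module.finrank ℝ (RiemMap.rangeSpace I₁ I₂ F p)) :
    (RiemMap.IsPseudoUmbilical I₁ I₂ F ↔
      ∀ X Y : (∀ p : M₁, TangentSpace I₁ p),
        RiemMap.IsHorizontalField I₁ I₂ F X → RiemMap.IsHorizontalField I₁ I₂ F Y →
        ∀ p : M₁,
          inner ℝ (RiemMap.secondFundamentalForm I₁ I₂ F X Y p) (RiemMap.meanCurvature I₁ I₂ F p)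
            = inner ℝ (X p) (Y p) * ‖RiemMap.meanCurvature I₁ I₂ F p‖ ^ 2) ∧
    (∀ lam : M₁ → ℝ, RiemMap.IsPseudoUmbilicalWith I₁ I₂ F lam →
      ∀ p : M₁, lam p = ‖RiemMap.meanCurvature I₁ I₂ F p‖ ^ 2) := by
  have hH : ContMDiff I₁ 𝓘(ℝ, ℝ) ∞ fun p => ‖RiemMap.meanCurvature I₁ I₂ F p‖ ^ 2 := fun p => by
    obtain ⟨O, U, f, s, hp, hO, hf, hs⟩ := RiemMap.exists_frames (I₁ := I₁) (I₂ := I₂)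
      hF.contMDiff.continuous p
    have h := RiemMap.smoothAlong_meanCurvature hF hrank hf hs hO
    simp only [← real_inner_self_eq_norm_sq]
    exact (h.contMDiffOn_inner hs hO h).contMDiffAt (hf.isOpen.mem_nhds hp)
  have hiso : ∀ X Y : (∀ p : M₁, TangentSpace I₁ p), RiemMap.IsHorizontalField I₁ I₂ F X →
      RiemMap.IsHorizontalField I₁ I₂ F Y → ∀ p, (inner ℝ (RiemMap.push I₁ I₂ F X p)
        (RiemMap.push I₁ I₂ F Y p) : ℝ) = inner ℝ (X p) (Y p) := fun X Y hX hY p =>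
    hF.inner_eq p _ (hX.mem p) _ (hY.mem p)
  have hff : ∀ lam : M₁ → ℝ, RiemMap.IsPseudoUmbilicalWith I₁ I₂ F lam →
      ∀ X Y : (∀ p : M₁, TangentSpace I₁ p), RiemMap.IsHorizontalField I₁ I₂ F X →
      RiemMap.IsHorizontalField I₁ I₂ F Y → ∀ p,
      inner ℝ (RiemMap.secondFundamentalForm I₁ I₂ F X Y p) (RiemMap.meanCurvature I₁ I₂ F p)
        = lam p * inner ℝ (X p) (Y p) := fun lam hlam X Y hX hY p => by
    rw [← RiemMap.inner_shapeOperator_meanCurvature hF hrank hY.contMDiff, hlam.shape_eq X hX p,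
      real_inner_smul_left, hiso X Y hX hY]
  have hlam : ∀ lam : M₁ → ℝ, RiemMap.IsPseudoUmbilicalWith I₁ I₂ F lam →
      ∀ p : M₁, lam p = ‖RiemMap.meanCurvature I₁ I₂ F p‖ ^ 2 := fun lam h p =>
    RiemMap.eq_norm_sq_of_inner_secondFundamentalForm hF (hrank p)
      fun X Y hX hY => hff lam h X Y hX hY p
  refine ⟨⟨fun ⟨lam, h⟩ X Y hX hY p => ?_, fun h => ⟨_, hH, fun X hX p => ?_⟩⟩, hlam⟩
  · rw [hff lam h X Y hX hY, hlam lam h, mul_comm]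
  · -- The difference of the two sides lies in `range F_*` and is orthogonal to it.
    rw [← sub_eq_zero, ← inner_self_eq_zero (𝕜 := ℝ)]
    have hmem : RiemMap.shapeOperator I₁ I₂ F (RiemMap.meanCurvature I₁ I₂ F) X p
        - ‖RiemMap.meanCurvature I₁ I₂ F p‖ ^ 2 • RiemMap.push I₁ I₂ F X p
          ∈ RiemMap.rangeSpace I₁ I₂ F p :=
      sub_mem (neg_mem (Submodule.starProjection_apply_mem _ _))
        (Submodule.smul_mem _ _ (RiemMap.push_mem_rangeSpace _ _))
    obtain ⟨v, hv⟩ := hmem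
    obtain ⟨Y, hY, hYp, -⟩ := RiemMap.exists_isHorizontalField hF
      (Submodule.starProjection_apply_mem (RiemMap.horizontalSpace I₁ I₂ F p) v)
    have hYv : RiemMap.push I₁ I₂ F Y p
        = RiemMap.shapeOperator I₁ I₂ F (RiemMap.meanCurvature I₁ I₂ F) X p
          - ‖RiemMap.meanCurvature I₁ I₂ F p‖ ^ 2 • RiemMap.push I₁ I₂ F X p := by
      rw [← hv, RiemMap.push, hYp]
      exact RiemMap.map_starProjection_orthogonal_ker (mfderiv I₁ I₂ F p).toLinearMap v
    nth_rewrite 2 [← hYv]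
    rw [inner_sub_left, RiemMap.inner_shapeOperator_meanCurvature hF hrank hY.contMDiff,
      real_inner_smul_left, hiso X Y hX hY, h X Y hX hY, mul_comm, sub_self]
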